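/- For each dimension $d\ge 1$ let $f=N(0,I)$ be the standard Gaussian distribution on $\mathbb{R}^d$ and let $A=A_d\subset\mathbb{R}^d$ be a measurable set, with $p_f(A)=\int_A f$, and assume that $\inf_{d\ge 1} p_f(A)>0$. Let $f|_A=f\,\mathbf 1_A/p_f(A)$ be the distribution $f$ conditioned on $A$, and let $\mu_A$ and $\Sigma_A$ be the mean and the covariance matrix of $f|_A$. Let $n_g=n_g(d)$ be a sequence of integers and, for each $d$, let $Y_{A,1},\dots,Y_{A,n_g}$ be i.i.d. random vectors with distribution $N(\mu_A,\Sigma_A)$. Put $$\hat\mu_A=\frac1{n_g}\sum_{k=1}^{n_g}Y_{A,k},\qquad \hat\Sigma_A=\frac1{n_g}\sum_{k=1}^{n_g}Y_{A,k}Y_{A,k}^\top-\hat\mu_A\hat\mu_A^\top,\qquad \hat g_A=N(\hat\mu_A,\hat\Sigma_A),$$ and let $D(f\|\hat g_A)\in[0,\infty]$ be the Kullback--Leibler divergence. For sequences $u,v$ indexed by $d$, write $u\gg v$, or equivalently $v\ll u$, if $u/v\to\infty$ as $d\to\infty$. Assume that $n_g\gg d$. Then: (a) if $n_g\gg d^2$,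 then $\sup_d\mathbb{E}[D(f\|\hat g_A)]<\infty$, where the supremum is over all $d\ge1$ with $n_g(d)\ge d+3$ (that is, over all but finitely many $d$, because $n_g\gg d$); (b) if $n_g\ll d^2$, then $\mathbb{E}[D(f\|\hat g_A)]\to\infty$ as $d\to\infty$. -/

import Mathlib

open MeasureTheory ProbabilityTheory InformationTheory Filter Topology
open scoped ENNReal

noncomputable section

namespace GaussianIS

/-- The standard Gaussian distribution `f = N(0, I)` on `ℝ^d`. -/
abbrev f (d : ℕ) : Measure (EuclideanSpace ℝ (Fin d)) :=
  stdGaussian (EuclideanSpace ℝ (Fin d))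

/-- The conditional distribution `f|_A`, that is `f` restricted to `A` and divided by `p_f(A)`. -/
def condLaw {d : ℕ} (A : Set (EuclideanSpace ℝ (Fin d))) :
    Measure (EuclideanSpace ℝ (Fin d)) :=
  ProbabilityTheory.cond (f d) A

/-- The mean `μ_A = E_{f|_A}(X)`. -/
def meanA {d : ℕ} (A : Set (EuclideanSpace ℝ (Fin d))) : EuclideanSpace ℝ (Fin d) :=
  ∫ x, x ∂(condLaw A)

/-- The covariance matrix `Σ_A = E_{f|_A}(X Xᵀ) - μ_A μ_Aᵀ`. -/
def covA {d : ℕ} (A : Set (EuclideanSpace ℝ (Fin d))) : Matrix (Fin d) (Fin d) ℝ :=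
  Matrix.of fun i j => (∫ x, x i * x j ∂(condLaw A)) - meanA A i * meanA A j

/-- The empirical mean `(1/n) ∑ₖ yₖ` of a sample of size `n`. -/
def sampleMean {d n : ℕ} (y : Fin n → EuclideanSpace ℝ (Fin d)) : EuclideanSpace ℝ (Fin d) :=
  (1 / (n : ℝ)) • ∑ k, y k

/-- The empirical covariance matrix `(1/n) ∑ₖ yₖ yₖᵀ - μ̂ μ̂ᵀ` of a sample of size `n`. -/
def sampleCov {d n : ℕ} (y : Fin n → EuclideanSpace ℝ (Fin d)) : Matrix (Fin d) (Fin d) ℝ :=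
  Matrix.of fun i j =>
    (1 / (n : ℝ)) * (∑ k, y k i * y k j) - sampleMean y i * sampleMean y j

/-- The estimated Gaussian distribution `ĝ = N(μ̂, Σ̂)`. -/
def gHat {d n : ℕ} (y : Fin n → EuclideanSpace ℝ (Fin d)) :
    Measure (EuclideanSpace ℝ (Fin d)) :=
  multivariateGaussian (sampleMean y) (sampleCov y)

/-- The expected Kullback–Leibler divergence `E(D(f ‖ ĝ))` in `[0, ∞]`, where `ĝ` is computed from
the random sample `Y`. -/
def expectedKL {Ω : Type*} [MeasurableSpace Ω] (P : Measure Ω) {d n : ℕ}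
    (Y : Fin n → Ω → EuclideanSpace ℝ (Fin d)) : ℝ≥0∞ :=
  ∫⁻ ω, klDiv (f d) (gHat fun k => Y k ω) ∂P

/-- `u ≫ v` for two sequences indexed by the dimension: `u / v → ∞` as `d → ∞`. -/
def MuchLarger (u v : ℕ → ℝ) : Prop :=
  Tendsto (fun d => u d / v d) atTop atTop

end GaussianIS

end

/-! Write `Σ_A = B Bᵀ` with `BᵀB = diag(λ)` and `μ_A = B m₀`. Standardize the sample and rotate the
sample space `ℝⁿ` so that its first basis vector is constant. Then `μ̂ = B (m₀ + w/√n)` and `Σ̂ = B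
(G/n) Bᵀ`, where `w` is standard Gaussian and `G` is the Gram matrix of `d` standard Gaussian
vectors of `ℝⁿ⁻¹`, independent of `w`. The Gaussian divergence formula gives, almost surely, `2
D(f‖ĝ) = log det Σ_A + log det G - d log n + n ∑ λᵢ⁻¹ (G⁻¹)ᵢᵢ - d + (√n m₀ + w)ᵀ G⁻¹ (√n m₀ + w)`
(`klDiv_gHat_affine`, `expectedKL_eq`).

Conditioning is harmless. If `p` is a uniform lower bound of `p_f(A)`, then `f|_A ≤ p⁻¹ f`, which
forces `‖μ_A‖² ≤ p⁻¹`, `λᵢ ≥ p²/8` and `∑ (λᵢ - 1)² ≤ K`, with `K` depending only on `p`. Hence `∑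
(log λᵢ + λᵢ⁻¹ - 1)` lies between `0` and a constant.

The random part rests on `(G⁻¹)ᵢᵢ`, the inverse squared distance from one Gaussian vector to the
span of the others, that is, the inverse of a chi-square variable with `n - d` degrees of freedom.
Its mean lies between `1/(n-d)` and `1/(n-d-2)`. Off-diagonal entries have mean zero by symmetry.

Upper bound: `log det (G/n) ≤ tr (G/n) - d` has nonpositive mean, and the factor `n/(n-d-2) = 1 +
O(d/n)` in front of `∑ λᵢ⁻¹ = O(d)` costs only `O(d²/n)`. Lower bound: the mean term is nonnegative
and is dropped; the trace gains nearly `d²/n`, while the log-determinant loses about `d²/(2n)`, so a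
positive multiple of `d²/n` survives. Both are in `expectedKL_bounds`. -/

namespace GaussianIS

open scoped RealInnerProductSpace

/-! ### Standard Gaussian measures: products, projections, inverse moments of the norm -/

section StdGaussian

variable {E : Type*} [NormedAddCommGroup E] [InnerProductSpace ℝ E] [FiniteDimensional ℝ E]
  [MeasurableSpace E] [BorelSpace E]

/-- A product of standard Gaussian measures is the standard Gaussian measure of the `ℓ²` sum. -/
lemma map_toLp_pi_stdGaussian {ι : Type*} [Fintype ι] :
    (Measure.pi fun _ : ι => stdGaussian E).map (WithLp.toLp 2) =
      stdGaussian (PiLp 2 fun _ : ι => E) := by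
  apply Measure.ext_of_charFun
  ext t
  rw [charFun_stdGaussian, charFun_pi]
  simp_rw [charFun_stdGaussian, ← Complex.exp_sum, ← Complex.ofReal_pow, PiLp.norm_sq_eq_of_L2]
  simp [Finset.sum_div, neg_div]

lemma map_toLp_prod_stdGaussian {F : Type*} [NormedAddCommGroup F] [InnerProductSpace ℝ F]
    [FiniteDimensional ℝ F] [MeasurableSpace F] [BorelSpace F] :
    ((stdGaussian E).prod (stdGaussian F)).map (WithLp.toLp 2) =
      stdGaussian (WithLp 2 (E × F)) := by
  apply Measure.ext_of_charFun
  ext t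
  rw [charFun_stdGaussian, charFun_prod]
  simp_rw [charFun_stdGaussian, ← Complex.exp_add, ← Complex.ofReal_pow,
    WithLp.prod_norm_sq_eq_of_L2]
  congr 1
  push_cast
  simp only [WithLp.fst, WithLp.snd]
  ring

lemma map_orthogonalProjectionOnto_stdGaussian (W : Submodule ℝ E) :
    (stdGaussian E).map W.orthogonalProjectionOnto = stdGaussian W := by
  apply Measure.ext_of_charFun
  ext t
  have h := charFun_stdGaussian (t : E)
  rw [charFun_apply] at h
  rw [charFun_stdGaussian, charFun_apply, integral_map (by fun_prop) (by fun_prop)]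
  simp only [Submodule.coe_norm] at *
  rw [← h]
  congr 1 with x
  congr 3
  exact Submodule.inner_orthogonalProjectionOnto_eq_of_mem_right t x

lemma map_inner_stdGaussian (u : E) :
    (stdGaussian E).map (fun x => ⟪u, x⟫) = gaussianReal 0 (‖u‖ ^ 2).toNNReal := by
  have h := IsGaussian.map_eq_gaussianReal (μ := stdGaussian E) (innerSL ℝ u)
  rw [integral_strongDual_stdGaussian, variance_dual_stdGaussian, innerSL_apply_norm] at h
  exact h

lemma integral_sq_gaussianReal : ∫ x, x ^ 2 ∂(gaussianReal 0 1) = 1 := by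
  have h := variance_fun_id_gaussianReal (μ := 0) (v := 1)
  rw [variance_of_integral_eq_zero (by fun_prop) (by simp)] at h
  simpa using h

lemma integrable_sq_gaussianReal : Integrable (fun x : ℝ => x ^ 2) (gaussianReal 0 1) :=
  (memLp_id_gaussianReal (μ := 0) (v := 1) 2).integrable_sq

lemma integrable_norm_sq_stdGaussian : Integrable (fun x => ‖x‖ ^ 2) (stdGaussian E) :=
  (IsGaussian.memLp_two_id (μ := stdGaussian E)).integrable_norm_pow (by norm_num)

lemma integral_inner_sq_stdGaussian (u : E) : ∫ x, ⟪u, x⟫ ^ 2 ∂(stdGaussian E) = ‖u‖ ^ 2 := by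
  have h := variance_dual_stdGaussian (innerSL ℝ u)
  rw [variance_of_integral_eq_zero (by fun_prop) (integral_strongDual_stdGaussian _), innerSL_apply_norm] at h
  exact h

lemma integral_norm_sq_stdGaussian :
    ∫ x, ‖x‖ ^ 2 ∂(stdGaussian E) = Module.finrank ℝ E := by
  have b := stdOrthonormalBasis ℝ E
  simp_rw [← b.sum_sq_inner_right]
  rw [integral_finsetSum]
  · simp [integral_inner_sq_stdGaussian]
  · intro i _
    refine (integrable_norm_sq_stdGaussian (E := E)).mono' (by fun_prop) (.of_forall fun x => ?_)
    have := abs_real_inner_le_norm (b i) x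
    simp only [b.norm_eq_one, one_mul] at this
    rw [Real.norm_eq_abs, abs_pow]
    gcongr

lemma integral_exp_neg_mul_sq_gaussianReal {t : ℝ} (ht : 0 ≤ t) :
    ∫ x, Real.exp (-(t * x ^ 2)) ∂(gaussianReal 0 1) = (1 + 2 * t) ^ (-(1 / 2 : ℝ)) := by
  rw [integral_gaussianReal_eq_integral_smul one_ne_zero]
  have : ∀ x : ℝ, gaussianPDFReal 0 1 x • Real.exp (-(t * x ^ 2)) =
      (√(2 * Real.pi))⁻¹ * Real.exp (-(t + 1 / 2) * x ^ 2) := by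
    intro x
    simp only [gaussianPDFReal, NNReal.coe_one, mul_one, sub_zero, smul_eq_mul, mul_assoc]
    rw [← Real.exp_add]
    congr 2
    ring
  simp_rw [this]
  rw [integral_const_mul, integral_gaussian, Real.rpow_neg (by linarith), ← Real.sqrt_eq_rpow,
    ← Real.sqrt_inv, ← Real.sqrt_inv, ← Real.sqrt_mul (by positivity)]
  congr 1
  have := Real.pi_pos
  have hb : 0 < t + 1 / 2 := by linarith
  field_simp
  ring

/-- The Laplace transform of a chi-square law factors over orthonormal coordinates. Integrated in
`t`, it yields the inverse moment below. -/
lemma lintegral_exp_neg_mul_norm_sq_stdGaussian {t : ℝ} (ht : 0 ≤ t) :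
    ∫⁻ x, ENNReal.ofReal (Real.exp (-(t * ‖x‖ ^ 2))) ∂(stdGaussian E) =
      ENNReal.ofReal ((1 + 2 * t) ^ (-(Module.finrank ℝ E / 2 : ℝ))) := by
  have hI : Integrable (fun x : E => Real.exp (-(t * ‖x‖ ^ 2))) (stdGaussian E) := by
    refine Integrable.of_bound (C := 1) (by fun_prop) (.of_forall fun x => ?_)
    rw [Real.norm_eq_abs, abs_of_pos (Real.exp_pos _), Real.exp_le_one_iff]
    have := mul_nonneg ht (sq_nonneg ‖x‖)
    linarith
  rw [← ofReal_integral_eq_lintegral_ofReal hI (.of_forall fun x => (Real.exp_pos _).le)]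
  congr 1
  have b := stdOrthonormalBasis ℝ E
  rw [stdGaussian_eq_map_pi_orthonormalBasis b,
    integral_map (Measurable.aemeasurable (by fun_prop)) (by fun_prop)]
  have : ∀ x : Fin (Module.finrank ℝ E) → ℝ,
      Real.exp (-(t * ‖∑ i, x i • b i‖ ^ 2)) = ∏ i, Real.exp (-(t * x i ^ 2)) := by
    intro x
    rw [← Real.exp_sum, ← b.sum_sq_inner_right (∑ i, x i • b i)]
    congr 1
    rw [Finset.mul_sum, ← Finset.sum_neg_distrib]
    refine Finset.sum_congr rfl fun i _ => ?_
    rw [b.orthonormal.inner_right_fintype]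
  simp_rw [this]
  rw [integral_fintype_prod_eq_prod (fun _ (y : ℝ) => Real.exp (-(t * y ^ 2)))]
  simp_rw [integral_exp_neg_mul_sq_gaussianReal ht]
  rw [Finset.prod_const, ← Real.rpow_natCast, ← Real.rpow_mul (by linarith)]
  congr 1
  simp
  ring

lemma lintegral_Ioi_one_add_two_mul_rpow {k : ℝ} (hk : 2 < k) :
    ∫⁻ t in Set.Ioi (0 : ℝ), ENNReal.ofReal ((1 + 2 * t) ^ (-(k / 2))) =
      ENNReal.ofReal (1 / (k - 2)) := by
  have hd : ∀ t ∈ Set.Ici (0 : ℝ), HasDerivAt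
      (fun t : ℝ => -(1 / (k - 2)) * (1 + 2 * t) ^ (-(k / 2) + 1)) ((1 + 2 * t) ^ (-(k / 2))) t := by
    intro t ht
    have ht : 0 ≤ t := ht
    have h1 : HasDerivAt (fun t : ℝ => 1 + 2 * t) 2 t := by
      simpa using ((hasDerivAt_id t).const_mul 2).const_add 1
    have h2 := (h1.rpow_const (p := -(k / 2) + 1) (Or.inl (by linarith))).const_mul (-(1 / (k - 2)))
    refine h2.congr_deriv ?_
    have : k - 2 ≠ 0 := by linarith
    rw [add_sub_cancel_right]
    field_simp
    ring
  have hlim : Tendsto (fun t : ℝ => -(1 / (k - 2)) * (1 + 2 * t) ^ (-(k / 2) + 1)) atTop (𝓝 0) := by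
    have h0 : Tendsto (fun t : ℝ => 1 + 2 * t) atTop atTop :=
      tendsto_atTop_add_const_left _ _ (tendsto_id.const_mul_atTop two_pos)
    have h := (tendsto_rpow_neg_atTop (y := k / 2 - 1) (by linarith)).comp h0
    simpa [Function.comp_def, neg_sub, sub_eq_neg_add, add_comm] using h.const_mul (-(1 / (k - 2)))
  have hnn : ∀ t ∈ Set.Ioi (0 : ℝ), 0 ≤ (1 + 2 * t) ^ (-(k / 2)) := fun t ht =>
    Real.rpow_nonneg (by have : 0 < t := ht; linarith) _
  have hint := integrableOn_Ioi_deriv_of_nonneg' hd hnn hlim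
  rw [← ofReal_integral_eq_lintegral_ofReal hint
    ((ae_restrict_iff' measurableSet_Ioi).2 (.of_forall hnn)),
    integral_Ioi_of_hasDerivAt_of_tendsto' hd hint hlim]
  simp

/-- An equality for `s > 0`. At `s = 0` the left side is `0` by the convention `0⁻¹ = 0` and the
right side is infinite, so only the inequality holds throughout. -/
lemma ofReal_inv_le_lintegral_exp {s : ℝ} (hs : 0 ≤ s) :
    ENNReal.ofReal s⁻¹ ≤ ∫⁻ t in Set.Ioi (0 : ℝ), ENNReal.ofReal (Real.exp (-(t * s))) := by
  rcases hs.eq_or_lt with rfl | hs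
  · simp
  have hI := integrableOn_exp_mul_Ioi (a := -s) (by linarith) 0
  have h := integral_exp_mul_Ioi (a := -s) (by linarith) 0
  simp_rw [show ∀ t, -(t * s) = -s * t by intro t; ring]
  rw [← ofReal_integral_eq_lintegral_ofReal hI (.of_forall fun x => (Real.exp_pos _).le), h]
  simp

/-- Write `1/s = ∫ exp(-ts) dt` and exchange the integrals: with `k` the dimension, the value is `∫
(1+2t)^(-k/2) dt = 1/(k-2)`. -/
lemma lintegral_inv_norm_sq_stdGaussian_le (hk : 3 ≤ Module.finrank ℝ E) :
    ∫⁻ x, ENNReal.ofReal (‖x‖ ^ 2)⁻¹ ∂(stdGaussian E) ≤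
      ENNReal.ofReal (1 / (Module.finrank ℝ E - 2 : ℝ)) := by
  have hk' : (2 : ℝ) < Module.finrank ℝ E := by exact_mod_cast hk
  calc ∫⁻ x, ENNReal.ofReal (‖x‖ ^ 2)⁻¹ ∂(stdGaussian E)
      ≤ ∫⁻ x, (∫⁻ t in Set.Ioi (0 : ℝ), ENNReal.ofReal (Real.exp (-(t * ‖x‖ ^ 2))))
          ∂(stdGaussian E) := lintegral_mono fun x => ofReal_inv_le_lintegral_exp (by positivity)
    _ = ∫⁻ t in Set.Ioi (0 : ℝ), ∫⁻ x, ENNReal.ofReal (Real.exp (-(t * ‖x‖ ^ 2)))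
          ∂(stdGaussian E) := by
        refine lintegral_lintegral_swap (Measurable.aemeasurable ?_)
        simp only [Function.uncurry_def]
        fun_prop
    _ = ∫⁻ t in Set.Ioi (0 : ℝ),
          ENNReal.ofReal ((1 + 2 * t) ^ (-(Module.finrank ℝ E / 2 : ℝ))) :=
        setLIntegral_congr_fun measurableSet_Ioi fun t ht =>
          lintegral_exp_neg_mul_norm_sq_stdGaussian (le_of_lt ht)
    _ = _ := lintegral_Ioi_one_add_two_mul_rpow hk'

/-- A proper subspace lies in a hyperplane `u⊥`, and `⟪u, x⟫` is a nondegenerate real Gaussian,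
which has no atoms. -/
lemma stdGaussian_submodule_eq_zero {V : Submodule ℝ E} (hV : V ≠ ⊤) :
    stdGaussian E (V : Set E) = 0 := by
  obtain ⟨u, hu, hu0⟩ := V.orthogonal.ne_bot_iff.1 (by rwa [ne_eq, Submodule.orthogonal_eq_bot_iff])
  have h : stdGaussian E ((fun x => ⟪u, x⟫) ⁻¹' {0}) = 0 := by
    rw [← Measure.map_apply (by fun_prop) (measurableSet_singleton _), map_inner_stdGaussian]
    have : NullSingletonClass (gaussianReal 0 (‖u‖ ^ 2).toNNReal) := by
      apply nullSingletonClass_gaussianReal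
      simpa using hu0
    simp
  refine measure_mono_null (fun x hx => ?_) h
  exact Submodule.inner_left_of_mem_orthogonal hx hu

end StdGaussian

end GaussianIS

namespace GaussianIS

open scoped RealInnerProductSpace
open Matrix (gram)

/-! ### Gram matrices of independent Gaussian vectors: inverse entries and determinant -/

section GramMatrix

variable {E : Type*} [NormedAddCommGroup E] [InnerProductSpace ℝ E]

lemma isUnit_det_gram {ι : Type*} [Fintype ι] [DecidableEq ι] {x : ι → E}
    (hx : LinearIndependent ℝ x) : IsUnit (gram ℝ x).det :=
  isUnit_iff_ne_zero.2 (Matrix.det_gram_ne_zero_iff_linearIndependent.2 hx)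

lemma inv_gram_apply_self_nonneg {ι : Type*} [Fintype ι] [DecidableEq ι] (x : ι → E) (i : ι) :
    0 ≤ (gram ℝ x)⁻¹ i i :=
  (Matrix.posSemidef_gram (𝕜 := ℝ) x).inv.diag_nonneg

lemma inv_gram_apply_self_pos {ι : Type*} [Fintype ι] [DecidableEq ι] {x : ι → E}
    (hx : LinearIndependent ℝ x) (i : ι) : 0 < (gram ℝ x)⁻¹ i i :=
  (Matrix.posDef_gram_of_linearIndependent hx).inv.diag_pos

/-- The diagonal entries of the inverse of a Gram matrix are the inverse squared distances of
each vector to the span of the others. -/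
lemma inv_gram_apply_self {d : ℕ} [FiniteDimensional ℝ E] {x : Fin (d + 1) → E}
    (hx : LinearIndependent ℝ x) (i : Fin (d + 1)) {V : Submodule ℝ E}
    (hV : V = Submodule.span ℝ (Set.range fun j => x (i.succAbove j))) :
    (gram ℝ x)⁻¹ i i = (‖Vᗮ.orthogonalProjectionOnto (x i)‖ ^ 2)⁻¹ := by
  set A := (gram ℝ x)⁻¹ with hA
  set q : E := Vᗮ.orthogonalProjectionOnto (x i) with hq
  -- Row `i` of the inverse Gram matrix gives the dual vector: `⟪y, x k⟫ = δ_ik`. It is orthogonal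
  -- to `V` and agrees with `A i i • q` modulo `V`, hence equals it; pairing with `x i` gives the
  -- formula.
  set y : E := ∑ j, A i j • x j with hy
  have hyx : ∀ k, ⟪y, x k⟫ = (1 : Matrix (Fin (d + 1)) (Fin (d + 1)) ℝ) i k := by
    intro k
    rw [← Matrix.nonsing_inv_mul _ (isUnit_det_gram hx), Matrix.mul_apply, hy, sum_inner]
    refine Finset.sum_congr rfl fun j _ => ?_
    rw [real_inner_smul_left, Matrix.gram_apply]
  have hmem : ∀ j, x (i.succAbove j) ∈ V := fun j => by
    rw [hV]; exact Submodule.subset_span ⟨j, rfl⟩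
  have hyV : y ∈ Vᗮ := by
    rw [hV, Submodule.mem_orthogonal']
    intro v hv
    induction hv using Submodule.span_induction with
    | mem v hv =>
      obtain ⟨j, rfl⟩ := hv
      rw [hyx, Matrix.one_apply_ne (i.succAbove_ne j).symm]
    | zero => exact inner_zero_right _
    | add u v _ _ hu hv => rw [inner_add_right, hu, hv, add_zero]
    | smul c v _ hv => rw [inner_smul_right, hv, mul_zero]
  have hqV : q ∈ Vᗮ := Submodule.coe_mem _
  have hxq : x i - q ∈ V := by
    have := Vᗮ.sub_starProjection_mem_orthogonal (x i)
    rwa [Submodule.orthogonal_orthogonal] at this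
  have hyq : y = A i i • q := by
    have h1 : y - A i i • q ∈ V := by
      have : y - A i i • q =
          A i i • (x i - q) + ∑ j, A i (i.succAbove j) • x (i.succAbove j) := by
        rw [hy, Fin.sum_univ_succAbove _ i, smul_sub]
        abel
      rw [this]
      exact V.add_mem (V.smul_mem _ hxq) (V.sum_mem fun j _ => V.smul_mem _ (hmem j))
    have h2 : y - A i i • q ∈ Vᗮ := Vᗮ.sub_mem hyV (Vᗮ.smul_mem _ hqV)
    have h3 := Submodule.inner_right_of_mem_orthogonal h1 h2
    rw [inner_self_eq_zero, sub_eq_zero] at h3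
    exact h3
  have h1 := hyx i
  have hqx : ⟪q, x i⟫ = ‖q‖ ^ 2 := by
    have : ⟪q, x i - q⟫ = 0 := Submodule.inner_left_of_mem_orthogonal hxq hqV
    rw [inner_sub_right, real_inner_self_eq_norm_sq, sub_eq_zero] at this
    exact this
  rw [hyq, real_inner_smul_left, hqx, Matrix.one_apply_eq] at h1
  exact eq_inv_of_mul_eq_one_left h1

lemma det_gram_succ {d : ℕ} {x : Fin (d + 1) → E} (hx : LinearIndependent ℝ x) :
    (gram ℝ x).det * (gram ℝ x)⁻¹ 0 0 = (gram ℝ (fun j => x (Fin.succ j))).det := by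
  have h := (isUnit_det_gram hx).ne_zero
  rw [Matrix.inv_def, Matrix.smul_apply, Ring.inverse_eq_inv', smul_eq_mul,
    mul_inv_cancel_left₀ h, Matrix.adjugate_fin_succ_eq_det_submatrix]
  simp
  rfl

/-- Removing one vector changes the log-determinant by the logarithm of a diagonal inverse entry;
`log t ≤ t - 1` at `t = a (G⁻¹)₀₀` makes the bound linear in that entry, whose mean is controlled.
-/
lemma log_det_gram_succ_ge {d : ℕ} {x : Fin (d + 1) → E} (hx : LinearIndependent ℝ x) {a : ℝ}
    (ha : 0 < a) :
    Real.log (gram ℝ (fun j => x (Fin.succ j))).det + (1 - a * (gram ℝ x)⁻¹ 0 0 + Real.log a) ≤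
      Real.log (gram ℝ x).det := by
  have h := (isUnit_det_gram hx).ne_zero
  have h0 := inv_gram_apply_self_pos hx 0
  rw [← det_gram_succ hx, Real.log_mul h h0.ne']
  have h1 := Real.log_le_sub_one_of_pos (mul_pos ha h0)
  rw [Real.log_mul ha.ne' h0.ne'] at h1
  linarith

lemma continuous_gram {ι : Type*} [Finite ι] : Continuous fun x : ι → E => gram ℝ x := by
  refine continuous_matrix fun i j => ?_
  simp only [Matrix.gram_apply]
  fun_prop

/-- Positivity of the quadratic form at `eᵢ ± eⱼ`. It transfers integrability from the diagonal
entries to the others. -/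
lemma abs_inv_gram_le {d : ℕ} (x : Fin d → E) (i j : Fin d) :
    |(gram ℝ x)⁻¹ i j| ≤ (gram ℝ x)⁻¹ i i + (gram ℝ x)⁻¹ j j := by
  have hP := (Matrix.posSemidef_gram (𝕜 := ℝ) x).inv
  set A := (gram ℝ x)⁻¹
  have hs : A j i = A i j := by simpa using hP.1.apply i j
  have hq : ∀ s : ℝ, 0 ≤ A i i + 2 * s * A i j + s ^ 2 * A j j := by
    intro s
    have h := hP.dotProduct_mulVec_nonneg (Pi.single i 1 + Pi.single j s)
    simp only [star_trivial, Matrix.mulVec_add, Matrix.mulVec_single, dotProduct_add,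
      add_dotProduct, single_dotProduct, Pi.smul_apply, Matrix.col_apply, MulOpposite.smul_eq_mul_unop,
      MulOpposite.unop_op, hs] at h
    linarith
  have h1 := hq 1
  have h2 := hq (-1)
  have h3 : 0 ≤ A i i := hP.diag_nonneg
  have h4 : 0 ≤ A j j := hP.diag_nonneg
  rw [abs_le]
  constructor <;> linarith

lemma linearIndependent_insertNth {d : ℕ} (i : Fin (d + 1)) {v : E} {x : Fin d → E}
    (hx : LinearIndependent ℝ x) (hv : v ∉ Submodule.span ℝ (Set.range x)) :
    LinearIndependent ℝ (i.insertNth v x : Fin (d + 1) → E) := by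
  have h := linearIndependent_finCons.2 ⟨hx, hv⟩
  rwa [← linearIndependent_equiv i.cycleRange, Fin.cons_comp_cycleRange] at h

variable [FiniteDimensional ℝ E] [MeasurableSpace E] [BorelSpace E]

lemma measurable_det_gram {ι : Type*} [Fintype ι] [DecidableEq ι] :
    Measurable fun x : ι → E => (gram ℝ x).det :=
  (continuous_gram.matrix_det).measurable

lemma measurable_inv_gram {ι : Type*} [Fintype ι] [DecidableEq ι] (i j : ι) :
    Measurable fun x : ι → E => (gram ℝ x)⁻¹ i j := by
  simp only [Matrix.inv_def, Matrix.smul_apply, Ring.inverse_eq_inv', smul_eq_mul]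
  exact measurable_det_gram.inv.mul
    ((continuous_gram.matrix_adjugate).matrix_elem i j).measurable

lemma measurableSet_linearIndependent {ι : Type*} [Fintype ι] :
    MeasurableSet {x : ι → E | LinearIndependent ℝ x} := by
  classical
  have : {x : ι → E | LinearIndependent ℝ x} = {x | (gram ℝ x).det = 0}ᶜ := by
    ext x
    simp [← Matrix.det_gram_ne_zero_iff_linearIndependent (𝕜 := ℝ)]
  rw [this]
  exact (measurableSet_eq_fun measurable_det_gram measurable_const).compl

lemma lintegral_pi_stdGaussian_succ {d : ℕ} (i : Fin (d + 1)) {F : (Fin (d + 1) → E) → ℝ≥0∞}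
    (hF : Measurable F) :
    ∫⁻ x, F x ∂(Measure.pi fun _ => stdGaussian E) =
      ∫⁻ x, ∫⁻ v, F (i.insertNth v x) ∂(stdGaussian E) ∂(Measure.pi fun _ => stdGaussian E) := by
  have h := (measurePreserving_piFinSuccAbove (fun _ : Fin (d + 1) => stdGaussian E) i).symm
  rw [← h.lintegral_comp hF, lintegral_prod_symm _ (by fun_prop)]
  rfl

lemma ae_notMem_span {d : ℕ} (hd : d < Module.finrank ℝ E) (x : Fin d → E) :
    ∀ᵐ v ∂(stdGaussian E), v ∉ Submodule.span ℝ (Set.range x) := by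
  refine measure_eq_zero_iff_ae_notMem.1 (stdGaussian_submodule_eq_zero fun h => ?_)
  have h1 := finrank_range_le_card (R := ℝ) x
  rw [Set.finrank, h, finrank_top, Fintype.card_fin] at h1
  omega

lemma ae_linearIndependent {d : ℕ} (hd : d ≤ Module.finrank ℝ E) :
    ∀ᵐ x ∂(Measure.pi fun _ : Fin d => stdGaussian E), LinearIndependent ℝ x := by
  induction d with
  | zero => exact .of_forall fun x => linearIndependent_empty_type
  | succ d ih =>
    have hm := (measurableSet_linearIndependent (E := E) (ι := Fin (d + 1))).compl
    change (Measure.pi fun _ => stdGaussian E) {x : Fin (d + 1) → E | LinearIndependent ℝ x}ᶜ = 0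
    rw [← lintegral_indicator_one hm,
      lintegral_pi_stdGaussian_succ 0 (measurable_one.indicator hm)]
    refine (lintegral_eq_zero_of_ae_eq_zero ?_)
    filter_upwards [ih (by omega)] with x hx
    refine (lintegral_eq_zero_of_ae_eq_zero ?_)
    filter_upwards [ae_notMem_span (by omega) x] with v hv
    exact Set.indicator_of_notMem (Set.notMem_compl_iff.2 (linearIndependent_insertNth 0 hx hv)) _

/-- Freeze the other `d` vectors. Almost surely they span a `d`-dimensional `V`, and the projection
of the remaining vector to `Vᗮ` is standard Gaussian there, so bounds on every `W` of codimension
`d` suffice. A general `Φ` serves both the entry and its reciprocal. -/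
lemma lintegral_inv_gram_le {d : ℕ} (hd : d < Module.finrank ℝ E) (i : Fin (d + 1))
    {Φ : ℝ → ℝ≥0∞} (hΦ : Measurable Φ) {C : ℝ≥0∞}
    (h : ∀ W : Submodule ℝ E, Module.finrank ℝ W + d = Module.finrank ℝ E →
      ∫⁻ y, Φ (‖y‖ ^ 2)⁻¹ ∂(stdGaussian W) ≤ C) :
    ∫⁻ x, Φ ((gram ℝ x)⁻¹ i i) ∂(Measure.pi fun _ : Fin (d + 1) => stdGaussian E) ≤ C := by
  refine (lintegral_pi_stdGaussian_succ i (F := fun x => Φ ((gram ℝ x)⁻¹ i i))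
    (hΦ.comp (measurable_inv_gram i i))).trans_le ?_
  calc _ ≤ ∫⁻ x, C ∂(Measure.pi fun _ : Fin d => stdGaussian E) := ?_
    _ = C := by simp
  refine lintegral_mono_ae ?_
  filter_upwards [ae_linearIndependent hd.le] with x hx
  set V := Submodule.span ℝ (Set.range x) with hV
  have hr : Module.finrank ℝ Vᗮ + d = Module.finrank ℝ E := by
    have h1 : Module.finrank ℝ V = d := by simpa using finrank_span_eq_card hx
    have h2 := V.finrank_add_finrank_orthogonal
    omega
  refine le_trans (le_of_eq ?_) (h Vᗮ hr)
  rw [← map_orthogonalProjectionOnto_stdGaussian, lintegral_map (by fun_prop) (by fun_prop)]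
  refine lintegral_congr_ae ?_
  filter_upwards [ae_notMem_span hd x] with v hv
  have hV' : V = Submodule.span ℝ (Set.range fun j =>
      (i.insertNth v x : Fin (d + 1) → E) (i.succAbove j)) := by
    simp [hV]
  rw [inv_gram_apply_self (linearIndependent_insertNth i hx hv) i hV', Fin.insertNth_apply_same]

lemma integrable_and_integral_le_of_lintegral_le {α : Type*} [MeasurableSpace α] {μ : Measure α}
    {g : α → ℝ} (hg : Measurable g) (h0 : ∀ x, 0 ≤ g x) {c : ℝ} (hc : 0 ≤ c)
    (h : ∫⁻ x, ENNReal.ofReal (g x) ∂μ ≤ ENNReal.ofReal c) :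
    Integrable g μ ∧ ∫ x, g x ∂μ ≤ c := by
  refine ⟨⟨hg.aestronglyMeasurable, ?_⟩, ?_⟩
  · rw [hasFiniteIntegral_iff_ofReal (.of_forall h0)]
    exact h.trans_lt ENNReal.ofReal_lt_top
  · rw [integral_eq_lintegral_of_nonneg_ae (.of_forall h0) hg.aestronglyMeasurable]
    exact ENNReal.toReal_le_of_le_ofReal hc h

lemma integral_inv_gram_le {d : ℕ} (hd : d + 2 ≤ Module.finrank ℝ E) (i : Fin d) :
    Integrable (fun x : Fin d → E => (gram ℝ x)⁻¹ i i) (Measure.pi fun _ => stdGaussian E) ∧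
      ∫ x, (gram ℝ x)⁻¹ i i ∂(Measure.pi fun _ : Fin d => stdGaussian E) ≤
        1 / (Module.finrank ℝ E - d - 1 : ℝ) := by
  have hd' : (d + 2 : ℝ) ≤ Module.finrank ℝ E := by exact_mod_cast hd
  refine integrable_and_integral_le_of_lintegral_le (measurable_inv_gram i i)
    (fun x => inv_gram_apply_self_nonneg x i) (one_div_nonneg.2 (by linarith)) ?_
  obtain ⟨d, rfl⟩ : ∃ e, d = e + 1 := ⟨d - 1, by have := i.pos; omega⟩
  refine lintegral_inv_gram_le (by omega) i (by fun_prop) fun W hW => ?_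
  refine (lintegral_inv_norm_sq_stdGaussian_le (E := W) (by omega)).trans (le_of_eq ?_)
  congr 2
  rw [← hW]
  push_cast
  ring

lemma integral_inv_inv_gram_le {d : ℕ} (hd : d ≤ Module.finrank ℝ E) (i : Fin d) :
    Integrable (fun x : Fin d → E => ((gram ℝ x)⁻¹ i i)⁻¹) (Measure.pi fun _ => stdGaussian E) ∧
      ∫ x, ((gram ℝ x)⁻¹ i i)⁻¹ ∂(Measure.pi fun _ : Fin d => stdGaussian E) ≤
        (Module.finrank ℝ E - d + 1 : ℝ) := by
  have hd' : (d : ℝ) ≤ Module.finrank ℝ E := by exact_mod_cast hd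
  refine integrable_and_integral_le_of_lintegral_le (measurable_inv_gram i i).inv
    (fun x => inv_nonneg.2 (inv_gram_apply_self_nonneg x i)) (by linarith) ?_
  obtain ⟨d, rfl⟩ : ∃ e, d = e + 1 := ⟨d - 1, by have := i.pos; omega⟩
  refine lintegral_inv_gram_le (Φ := fun t => ENNReal.ofReal t⁻¹) (by omega) i (by fun_prop)
    fun W hW => ?_
  simp only [inv_inv]
  rw [← ofReal_integral_eq_lintegral_ofReal integrable_norm_sq_stdGaussian
    (.of_forall fun x => by positivity), integral_norm_sq_stdGaussian]
  refine ENNReal.ofReal_le_ofReal (le_of_eq ?_)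
  rw [← hW]
  push_cast
  ring

/-- The mean of a diagonal entry of the inverse of a Gaussian Gram matrix is at least the inverse
of the codimension. -/
lemma le_integral_inv_gram {d : ℕ} (hd : d + 2 ≤ Module.finrank ℝ E) (i : Fin d) :
    1 / (Module.finrank ℝ E - d + 1 : ℝ) ≤
      ∫ x, (gram ℝ x)⁻¹ i i ∂(Measure.pi fun _ : Fin d => stdGaussian E) := by
  have hd' : (d + 2 : ℝ) ≤ Module.finrank ℝ E := by exact_mod_cast hd
  set k : ℝ := Module.finrank ℝ E - d + 1 with hk
  have hk0 : 0 < k := by linarith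
  obtain ⟨h1, -⟩ := integral_inv_gram_le hd i
  obtain ⟨h2, h3⟩ := integral_inv_inv_gram_le (E := E) (by omega) i
  -- Jensen for `s ↦ 1/s`, through its tangent line at `s = k`; `k` bounds the mean of the
  -- reciprocal entry.
  have h4 : ∫ x, (2 / k - 1 / k ^ 2 * ((gram ℝ x)⁻¹ i i)⁻¹)
      ∂(Measure.pi fun _ : Fin d => stdGaussian E) ≤
      ∫ x, (gram ℝ x)⁻¹ i i ∂(Measure.pi fun _ : Fin d => stdGaussian E) := by
    refine integral_mono_ae ((integrable_const _).sub (h2.const_mul _)) h1 ?_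
    filter_upwards [ae_linearIndependent (E := E) (d := d) (by omega)] with x hx
    have hg := inv_gram_apply_self_pos hx i
    have : (gram ℝ x)⁻¹ i i - (2 / k - 1 / k ^ 2 * ((gram ℝ x)⁻¹ i i)⁻¹) =
        ((gram ℝ x)⁻¹ i i)⁻¹ * ((gram ℝ x)⁻¹ i i - 1 / k) ^ 2 := by
      field_simp
      ring
    have : 0 ≤ ((gram ℝ x)⁻¹ i i)⁻¹ * ((gram ℝ x)⁻¹ i i - 1 / k) ^ 2 := by positivity
    linarith
  rw [integral_sub (integrable_const _) (h2.const_mul _), integral_const_mul, integral_const] at h4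
  simp only [probReal_univ, one_smul] at h4
  have h5 := mul_le_mul_of_nonneg_left h3 (by positivity : 0 ≤ 1 / k ^ 2)
  have h6 : 1 / k ^ 2 * k = 1 / k := by field_simp
  have h7 : 2 / k = 1 / k + 1 / k := by ring
  linarith

/-- The log-determinant of a Gaussian Gram matrix has an integrable minorant with large mean. -/
lemma exists_le_log_det_gram {d : ℕ} (hd : d + 2 ≤ Module.finrank ℝ E) :
    ∃ L : (Fin d → E) → ℝ, Integrable L (Measure.pi fun _ => stdGaussian E) ∧
      (∀ᵐ x ∂(Measure.pi fun _ : Fin d => stdGaussian E), L x ≤ Real.log (gram ℝ x).det) ∧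
      ∑ i ∈ Finset.range d, Real.log (Module.finrank ℝ E - i - 2 : ℝ) ≤
        ∫ x, L x ∂(Measure.pi fun _ : Fin d => stdGaussian E) := by
  induction d with
  | zero => exact ⟨0, integrable_zero _ _ _, .of_forall fun x => by simp, by simp⟩
  | succ d ih =>
    obtain ⟨L, hL, hle, hint⟩ := ih (by omega)
    have hd' : (d + 3 : ℝ) ≤ Module.finrank ℝ E := by
      have : ((d + 1 + 2 : ℕ) : ℝ) ≤ Module.finrank ℝ E := by exact_mod_cast hd
      push_cast at this
      linarith
    -- The reciprocal of the bound on the mean of `(G⁻¹)₀₀` for `d + 1` vectors: `1 - a (G⁻¹)₀₀`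
    -- then has nonnegative mean and each step contributes at least `log a`.
    set a : ℝ := Module.finrank ℝ E - d - 2 with ha
    have ha0 : 0 < a := by linarith
    obtain ⟨h1, h2⟩ := integral_inv_gram_le hd (0 : Fin (d + 1))
    have hmp : MeasurePreserving (fun x : Fin (d + 1) → E => fun j => x (Fin.succ j))
        (Measure.pi fun _ => stdGaussian E) (Measure.pi fun _ => stdGaussian E) := by
      have := measurePreserving_snd.comp
        (measurePreserving_piFinSuccAbove (fun _ : Fin (d + 1) => stdGaussian E) 0)
      exact this
    have hL' := hmp.integrable_comp_of_integrable hL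
    refine ⟨fun x => L (fun j => x (Fin.succ j)) + (1 - a * (gram ℝ x)⁻¹ 0 0 + Real.log a),
      hL'.add (((integrable_const _).sub (h1.const_mul _)).add (integrable_const _)), ?_, ?_⟩
    · filter_upwards [hmp.quasiMeasurePreserving.ae hle, ae_linearIndependent (E := E) (d := d + 1)
        (by omega)] with x hx hx'
      have := log_det_gram_succ_ge hx' ha0
      linarith
    · have hI := (integrable_const (μ := Measure.pi fun _ : Fin (d + 1) => stdGaussian E)
        (1 : ℝ)).sub (h1.const_mul a)
      have e1 := integral_add hL' (hI.add (integrable_const (Real.log a)))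
      have e2 := integral_add hI (integrable_const (Real.log a))
      have e3 := integral_sub (integrable_const (μ := Measure.pi fun _ : Fin (d + 1) =>
        stdGaussian E) (1 : ℝ)) (h1.const_mul a)
      rw [integral_const_mul, integral_const] at e3
      rw [integral_const] at e2
      refine le_of_le_of_eq ?_ e1.symm
      refine le_of_le_of_eq ?_ (congrArg₂ _ rfl (e2.trans (congrArg₂ _ e3 rfl)).symm)
      rw [Finset.sum_range_succ]
      have h3 : ∫ x, L (fun j => x (Fin.succ j))
          ∂(Measure.pi fun _ : Fin (d + 1) => stdGaussian E) =
          ∫ x, L x ∂(Measure.pi fun _ : Fin d => stdGaussian E) := by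
        rw [← hmp.map_eq, integral_map hmp.measurable.aemeasurable]
        rw [hmp.map_eq]
        exact hL.aestronglyMeasurable
      change _ ≤ ∫ x, L (fun j => x (Fin.succ j))
          ∂(Measure.pi fun _ : Fin (d + 1) => stdGaussian E) + _
      rw [h3]
      have h4 := mul_le_mul_of_nonneg_left h2 ha0.le
      have h5 : a * (1 / (Module.finrank ℝ E - (d + 1 : ℕ) - 1 : ℝ)) = 1 := by
        rw [show (Module.finrank ℝ E - (d + 1 : ℕ) - 1 : ℝ) = a by rw [ha]; push_cast; ring]
        exact mul_one_div_cancel ha0.ne'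
      simp only [probReal_univ, one_smul]
      linarith

/-- Replacing `x i` by `-x i` preserves the law and changes the sign of this entry. -/
lemma integral_inv_gram_ne {d : ℕ} {i j : Fin d} (hij : i ≠ j) :
    ∫ x, (gram ℝ x)⁻¹ i j ∂(Measure.pi fun _ : Fin d => stdGaussian E) = 0 := by
  set D : Matrix (Fin d) (Fin d) ℝ := Matrix.diagonal fun k => if k = i then -1 else 1 with hD
  have hDD : D * D = 1 := by
    rw [hD, Matrix.diagonal_mul_diagonal, ← Matrix.diagonal_one]
    congr 1 with k
    split_ifs <;> simp
  set T : (Fin d → E) → (Fin d → E) :=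
    fun x k => (if k = i then LinearIsometryEquiv.neg ℝ else LinearIsometryEquiv.refl ℝ E) (x k)
    with hT
  have hmp : MeasurePreserving T (Measure.pi fun _ => stdGaussian E)
      (Measure.pi fun _ => stdGaussian E) := by
    refine measurePreserving_pi _ _ fun k => ⟨by fun_prop, ?_⟩
    exact stdGaussian_map _
  have hg : ∀ x, (gram ℝ (T x))⁻¹ = D * (gram ℝ x)⁻¹ * D := by
    intro x
    have : gram ℝ (T x) = D * gram ℝ x * D := by
      ext k l
      rw [hD, Matrix.mul_diagonal, Matrix.diagonal_mul, Matrix.gram_apply, Matrix.gram_apply, hT]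
      simp only
      split_ifs <;> simp
    rw [this, Matrix.mul_inv_rev, Matrix.mul_inv_rev, Matrix.inv_eq_right_inv hDD, Matrix.mul_assoc]
  have h : ∫ x, (gram ℝ x)⁻¹ i j ∂(Measure.pi fun _ : Fin d => stdGaussian E) =
      ∫ x, (gram ℝ (T x))⁻¹ i j ∂(Measure.pi fun _ : Fin d => stdGaussian E) := by
    nth_rw 1 [← hmp.map_eq]
    rw [integral_map hmp.measurable.aemeasurable (measurable_inv_gram i j).aestronglyMeasurable]
  have h' : ∀ x, (gram ℝ (T x))⁻¹ i j = -(gram ℝ x)⁻¹ i j := by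
    intro x
    rw [hg, hD, Matrix.mul_diagonal, Matrix.diagonal_mul]
    simp [hij.symm]
  simp_rw [h', integral_neg] at h
  linarith

lemma integrable_inv_gram {d : ℕ} (hd : d + 2 ≤ Module.finrank ℝ E) (i j : Fin d) :
    Integrable (fun x : Fin d → E => (gram ℝ x)⁻¹ i j) (Measure.pi fun _ => stdGaussian E) :=
  ((integral_inv_gram_le hd i).1.add (integral_inv_gram_le hd j).1).mono'
    (measurable_inv_gram i j).aestronglyMeasurable (.of_forall fun x => abs_inv_gram_le x i j)

end GramMatrix

end GaussianIS

namespace GaussianIS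

open scoped RealInnerProductSpace MatrixOrder
open Matrix (gram)

/-! ### Gaussian densities and the divergence from an affine image -/

section Density

variable {E : Type*} [NormedAddCommGroup E] [InnerProductSpace ℝ E] [FiniteDimensional ℝ E]
  [MeasurableSpace E] [BorelSpace E]

lemma stdGaussian_eq_withDensity_volume :
    stdGaussian E = volume.withDensity fun x : E =>
      ENNReal.ofReal ((2 * Real.pi) ^ (-(Module.finrank ℝ E / 2 : ℝ)) *
        Real.exp (-(‖x‖ ^ 2 / 2))) := by
  have hp : 0 < 2 * Real.pi := by positivity
  set K : ℝ := (2 * Real.pi) ^ (-(Module.finrank ℝ E / 2 : ℝ)) with hK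
  have hK0 : 0 < K := Real.rpow_pos_of_pos hp _
  have hint : Integrable (fun x : E => K * Real.exp (-(‖x‖ ^ 2 / 2))) := by
    have h := (GaussianFourier.integrable_cexp_neg_mul_sq_norm_add (V := E) (b := 1 / 2)
      (by norm_num) 0 0).norm
    refine Integrable.const_mul (h.congr (.of_forall fun x => ?_)) K
    simp only [Complex.norm_exp]
    congr 1
    simp [← Complex.ofReal_pow]
    ring
  have : IsFiniteMeasure (volume.withDensity fun x : E =>
      ENNReal.ofReal (K * Real.exp (-(‖x‖ ^ 2 / 2)))) :=
    isFiniteMeasure_withDensity_ofReal hint.2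
  apply Measure.ext_of_charFun
  ext t
  rw [charFun_stdGaussian, charFun_apply, integral_withDensity_eq_integral_toReal_smul
    (by fun_prop) (.of_forall fun x => ENNReal.ofReal_lt_top)]
  have h := GaussianFourier.integral_cexp_neg_mul_sq_norm_add (V := E) (b := 1 / 2)
    (by norm_num) Complex.I t
  have h2 : ∀ x : E, (ENNReal.ofReal (K * Real.exp (-(‖x‖ ^ 2 / 2)))).toReal •
      Complex.exp (⟪x, t⟫ * Complex.I) =
      K * Complex.exp (-(1 / 2) * ‖x‖ ^ 2 + Complex.I * ⟪t, x⟫) := by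
    intro x
    rw [ENNReal.toReal_ofReal (by positivity), Complex.real_smul, Complex.exp_add,
      real_inner_comm]
    push_cast
    rw [mul_assoc, mul_comm Complex.I]
    congr 3
    ring
  simp_rw [h2]
  rw [integral_const_mul, h, ← mul_assoc]
  have h3 : (K : ℂ) * (Real.pi / (1 / 2) : ℂ) ^ (Module.finrank ℝ E / 2 : ℂ) = 1 := by
    rw [show (Real.pi / (1 / 2) : ℂ) = ((2 * Real.pi : ℝ) : ℂ) by push_cast; ring,
      show (Module.finrank ℝ E / 2 : ℂ) = ((Module.finrank ℝ E / 2 : ℝ) : ℂ) by push_cast; rfl,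
      ← Complex.ofReal_cpow hp.le, ← Complex.ofReal_mul, hK, ← Real.rpow_add hp]
    simp
  rw [h3, one_mul]
  congr 1
  rw [Complex.I_sq]
  ring

/-- The density is the quotient of the two Lebesgue densities; the determinant comes from the change
of variables `x ↦ v + T x`. -/
lemma stdGaussian_eq_withDensity_map (T : E ≃L[ℝ] E) (v : E) :
    stdGaussian E = ((stdGaussian E).map fun x => v + T x).withDensity fun x =>
      ENNReal.ofReal (|LinearMap.det (T : E →ₗ[ℝ] E)| *
        Real.exp (-(‖x‖ ^ 2 / 2) + ‖T.symm (x - v)‖ ^ 2 / 2)) := by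
  have hdet : LinearMap.det (T : E →ₗ[ℝ] E) ≠ 0 := T.toLinearEquiv.isUnit_det'.ne_zero
  have hvol : (volume : Measure E) =
      ENNReal.ofReal |LinearMap.det (T : E →ₗ[ℝ] E)| • volume.map fun x => v + T x := by
    have h1 : (volume : Measure E).map T =
        ENNReal.ofReal |(LinearMap.det (T : E →ₗ[ℝ] E))⁻¹| • volume :=
      Measure.map_linearMap_addHaar_eq_smul_addHaar volume hdet
    have h2 : (volume : Measure E).map (fun x => v + T x) =
        ENNReal.ofReal |(LinearMap.det (T : E →ₗ[ℝ] E))⁻¹| • volume := by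
      rw [show (fun x => v + T x) = (fun x => v + x) ∘ T from rfl,
        ← Measure.map_map (by fun_prop) (by fun_prop), h1, Measure.map_smul, map_add_left_eq_self]
    rw [h2, smul_smul, ← ENNReal.ofReal_mul (abs_nonneg _), ← abs_mul, mul_inv_cancel₀ hdet]
    simp
  refine Measure.ext_of_lintegral _ fun g hg => ?_
  rw [lintegral_withDensity_eq_lintegral_mul _ (by fun_prop) hg, lintegral_map (by fun_prop)
    (by fun_prop)]
  conv_lhs => rw [stdGaussian_eq_withDensity_volume]
  conv_rhs => rw [stdGaussian_eq_withDensity_volume]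
  rw [lintegral_withDensity_eq_lintegral_mul _ (by fun_prop) hg,
    lintegral_withDensity_eq_lintegral_mul _ (by fun_prop) (by fun_prop)]
  conv_lhs => rw [hvol]
  rw [lintegral_smul_measure, lintegral_map (by fun_prop) (by fun_prop), smul_eq_mul,
    ← lintegral_const_mul _ (by fun_prop)]
  congr 1 with x
  simp only [Pi.mul_apply, add_sub_cancel_left, ContinuousLinearEquiv.symm_apply_apply]
  rw [← mul_assoc, ← mul_assoc, ← ENNReal.ofReal_mul (abs_nonneg _),
    ← ENNReal.ofReal_mul (by positivity)]
  congr 2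
  have : Real.exp (-(‖x‖ ^ 2 / 2)) * Real.exp (-(‖v + T x‖ ^ 2 / 2) + ‖x‖ ^ 2 / 2) =
      Real.exp (-(‖v + T x‖ ^ 2 / 2)) := by
    rw [← Real.exp_add]
    congr 1
    ring
  rw [← this]
  ring

lemma klDiv_stdGaussian_map (T : E ≃L[ℝ] E) (v : E) {F : E → ℝ}
    (hF : ∀ x, F x = Real.log |LinearMap.det (T : E →ₗ[ℝ] E)| +
      (-(‖x‖ ^ 2 / 2) + ‖T.symm (x - v)‖ ^ 2 / 2))
    (hint : Integrable F (stdGaussian E)) :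
    klDiv (stdGaussian E) ((stdGaussian E).map fun x => v + T x) =
      ENNReal.ofReal (∫ x, F x ∂(stdGaussian E)) := by
  set ν := (stdGaussian E).map fun x => v + T x with hν
  have hprob : IsProbabilityMeasure ν :=
    Measure.isProbabilityMeasure_map (Measurable.aemeasurable (by fun_prop))
  have hdet : LinearMap.det (T : E →ₗ[ℝ] E) ≠ 0 := T.toLinearEquiv.isUnit_det'.ne_zero
  have h := stdGaussian_eq_withDensity_map T v
  rw [← hν] at h
  have hac : stdGaussian E ≪ ν := by
    rw [h]
    exact withDensity_absolutelyContinuous _ _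
  have hrn := Measure.rnDeriv_withDensity ν (f := fun x =>
      ENNReal.ofReal (|LinearMap.det (T : E →ₗ[ℝ] E)| *
        Real.exp (-(‖x‖ ^ 2 / 2) + ‖T.symm (x - v)‖ ^ 2 / 2))) (by fun_prop)
  rw [← h] at hrn
  have hllr : llr (stdGaussian E) ν =ᵐ[stdGaussian E] F := by
    filter_upwards [hac.ae_le hrn] with x hx
    rw [llr_def]
    simp only
    rw [hx, ENNReal.toReal_ofReal (by positivity), Real.log_mul (by simpa using hdet)
      (Real.exp_pos _).ne', Real.log_exp, hF]
  rw [klDiv_of_ac_of_integrable hac ((integrable_congr hllr).2 hint), integral_congr_ae hllr]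
  simp

end Density

/-! ### Gaussian quadratic forms and the closed form of the divergence -/

section Quadratic

variable {d : ℕ}

lemma integral_inner_mul_inner_stdGaussian {E : Type*} [NormedAddCommGroup E]
    [InnerProductSpace ℝ E] [FiniteDimensional ℝ E] [MeasurableSpace E] [BorelSpace E] (u v : E) :
    Integrable (fun x => ⟪u, x⟫ * ⟪v, x⟫) (stdGaussian E) ∧
      ∫ x, ⟪u, x⟫ * ⟪v, x⟫ ∂(stdGaussian E) = ⟪u, v⟫ := by
  have hI : ∀ u : E, Integrable (fun x => ⟪u, x⟫ ^ 2) (stdGaussian E) := fun u =>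
    ((IsGaussian.memLp_two_id (μ := stdGaussian E)).const_inner u).integrable_sq
  have h : ∀ x, ⟪u, x⟫ * ⟪v, x⟫ =
      1 / 2 * (⟪u + v, x⟫ ^ 2 - ⟪u, x⟫ ^ 2 - ⟪v, x⟫ ^ 2) := by
    intro x
    rw [inner_add_left]
    ring
  simp_rw [h]
  refine ⟨(((hI _).sub (hI _)).sub (hI _)).const_mul _, ?_⟩
  have hs : Integrable (fun x => ⟪u + v, x⟫ ^ 2 - ⟪u, x⟫ ^ 2) (stdGaussian E) := (hI _).sub (hI _)
  rw [integral_const_mul, integral_sub hs (hI _), integral_sub (hI _) (hI _)]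
  simp_rw [integral_inner_sq_stdGaussian]
  rw [norm_add_sq_real]
  ring

lemma integral_coord_stdGaussian (i : Fin d) :
    Integrable (fun x : EuclideanSpace ℝ (Fin d) => x i) (f d) ∧ ∫ x, x i ∂(f d) = 0 := by
  have h := integral_strongDual_stdGaussian (EuclideanSpace.proj (𝕜 := ℝ) i)
  refine ⟨?_, h⟩
  exact (IsGaussian.integrable_id (μ := f d)).eval_piLp i

lemma integral_coord_mul_coord_stdGaussian (i j : Fin d) :
    Integrable (fun x : EuclideanSpace ℝ (Fin d) => x i * x j) (f d) ∧
      ∫ x, x i * x j ∂(f d) = (1 : Matrix (Fin d) (Fin d) ℝ) i j := by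
  have h := integral_inner_mul_inner_stdGaussian (EuclideanSpace.single i (1 : ℝ))
    (EuclideanSpace.single j (1 : ℝ))
  simp only [EuclideanSpace.inner_single_left, map_one, one_mul] at h
  simpa [Matrix.one_apply, Pi.single_apply] using h

lemma integral_add_coord_mul_add_coord (u : Fin d → ℝ) (i j : Fin d) :
    Integrable (fun x : EuclideanSpace ℝ (Fin d) => (u i + x i) * (u j + x j)) (f d) ∧
      ∫ x, (u i + x i) * (u j + x j) ∂(f d) =
        u i * u j + (1 : Matrix (Fin d) (Fin d) ℝ) i j := by
  obtain ⟨h1, e1⟩ := integral_coord_stdGaussian i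
  obtain ⟨h2, e2⟩ := integral_coord_stdGaussian j
  obtain ⟨h3, e3⟩ := integral_coord_mul_coord_stdGaussian i j
  have h : ∀ x : EuclideanSpace ℝ (Fin d), (u i + x i) * (u j + x j) =
      u i * u j + u i * x j + u j * x i + x i * x j := fun x => by ring
  simp_rw [h]
  have i0 := integrable_const (μ := f d) (u i * u j)
  refine ⟨((i0.add (h2.const_mul _)).add (h1.const_mul _)).add h3, ?_⟩
  rw [integral_add ((i0.fun_add (h2.const_mul _)).fun_add (h1.const_mul _)) h3,
    integral_add (i0.fun_add (h2.const_mul _)) (h1.const_mul _), integral_add i0 (h2.const_mul _),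
    e3, integral_const]
  simp_rw [integral_const_mul]
  rw [e1, e2]
  simp

lemma integral_quadratic_stdGaussian (M : Matrix (Fin d) (Fin d) ℝ) (u : Fin d → ℝ) :
    Integrable (fun x : EuclideanSpace ℝ (Fin d) => (u + x.ofLp) ⬝ᵥ M.mulVec (u + x.ofLp)) (f d) ∧
      ∫ x : EuclideanSpace ℝ (Fin d), (u + x.ofLp) ⬝ᵥ M.mulVec (u + x.ofLp) ∂(f d) =
        u ⬝ᵥ M.mulVec u + M.trace := by
  have h : ∀ y : Fin d → ℝ, y ⬝ᵥ M.mulVec y = ∑ i, ∑ j, M i j * (y i * y j) := by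
    intro y
    simp only [dotProduct, Matrix.mulVec, Finset.mul_sum]
    exact Finset.sum_congr rfl fun i _ => Finset.sum_congr rfl fun j _ => by ring
  simp_rw [h, Pi.add_apply]
  have hI := fun i j => (integral_add_coord_mul_add_coord u i j).1.const_mul (M i j)
  refine ⟨integrable_finsetSum _ fun i _ => integrable_finsetSum _ fun j _ => hI i j, ?_⟩
  rw [integral_finsetSum _ fun i _ => integrable_finsetSum _ fun j _ => hI i j]
  simp_rw [integral_finsetSum _ fun j _ => hI _ j, integral_const_mul,
    (integral_add_coord_mul_add_coord u _ _).2, mul_add, Finset.sum_add_distrib]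
  congr 1
  simp [Matrix.one_apply, Matrix.trace]

/-- The Kullback–Leibler divergence of the standard Gaussian with respect to a nondegenerate
Gaussian. -/
lemma klDiv_multivariateGaussian (v : EuclideanSpace ℝ (Fin d)) {S : Matrix (Fin d) (Fin d) ℝ}
    (hS : S.PosDef) :
    klDiv (f d) (multivariateGaussian v S) = ENNReal.ofReal
      ((Real.log S.det + S⁻¹.trace - d + v.ofLp ⬝ᵥ S⁻¹.mulVec v.ofLp) / 2) := by
  set R := CFC.sqrt S with hR
  have hRR : R * R = S := CFC.sqrt_mul_sqrt_self _ hS.posSemidef.nonneg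
  have hdetS : R.det * R.det = S.det := by rw [← Matrix.det_mul, hRR]
  have hSu : IsUnit S.det := hS.det_pos.ne'.isUnit
  have hRu : IsUnit R.det := isUnit_iff_ne_zero.2 fun h => by
    rw [h, zero_mul] at hdetS
    exact hS.det_pos.ne hdetS
  have hRs : R.transpose = R := by
    have := (CFC.sqrt_nonneg S).isSelfAdjoint
    rw [isSelfAdjoint_iff, Matrix.star_eq_conjTranspose] at this
    simpa using this
  set T : EuclideanSpace ℝ (Fin d) ≃L[ℝ] EuclideanSpace ℝ (Fin d) :=
    ContinuousLinearEquiv.equivOfInverse (Matrix.toEuclideanCLM (𝕜 := ℝ) R)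
      (Matrix.toEuclideanCLM (𝕜 := ℝ) R⁻¹)
      (fun x => by
        rw [← ContinuousLinearMap.comp_apply, ← ContinuousLinearMap.mul_def, ← map_mul,
          Matrix.nonsing_inv_mul _ hRu, map_one, one_apply_eq_self])
      (fun x => by
        rw [← ContinuousLinearMap.comp_apply, ← ContinuousLinearMap.mul_def, ← map_mul,
          Matrix.mul_nonsing_inv _ hRu, map_one, one_apply_eq_self]) with hT
  have hTdet : LinearMap.det (T : EuclideanSpace ℝ (Fin d) →ₗ[ℝ] EuclideanSpace ℝ (Fin d)) =
      R.det := by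
    rw [← LinearMap.det_toLin (EuclideanSpace.basisFun (Fin d) ℝ).toBasis]
    rfl
  have hTs : ∀ x, ‖T.symm x‖ ^ 2 = x.ofLp ⬝ᵥ S⁻¹.mulVec x.ofLp := by
    intro x
    have : T.symm x = Matrix.toEuclideanCLM (𝕜 := ℝ) R⁻¹ x := rfl
    rw [this, EuclideanSpace.real_norm_sq_eq, ← hRR, Matrix.mul_inv_rev, ← Matrix.mulVec_mulVec,
      Matrix.dotProduct_mulVec, ← Matrix.mulVec_transpose, Matrix.transpose_nonsing_inv, hRs]
    simp [dotProduct, sq, Matrix.ofLp_toEuclideanCLM]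
  have hlog : Real.log |R.det| = Real.log S.det / 2 := by
    rw [← hdetS, Real.log_mul hRu.ne_zero hRu.ne_zero, Real.log_abs]
    ring
  obtain ⟨q1, q2⟩ := integral_quadratic_stdGaussian S⁻¹ (-v.ofLp)
  have n1 := (integrable_norm_sq_stdGaussian (E := EuclideanSpace ℝ (Fin d))).div_const 2
  have c1 := integrable_const (μ := f d) (Real.log S.det / 2)
  set F : EuclideanSpace ℝ (Fin d) → ℝ := fun x => Real.log S.det / 2 +
      (-(‖x‖ ^ 2 / 2) + (-v.ofLp + x.ofLp) ⬝ᵥ S⁻¹.mulVec (-v.ofLp + x.ofLp) / 2) with hF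
  have hFint : Integrable F (stdGaussian _) := c1.add (n1.neg.add (q1.div_const 2))
  have key := klDiv_stdGaussian_map T v (F := F) (fun x => by
    rw [hTdet, hlog, hTs, hF, WithLp.ofLp_sub, sub_eq_neg_add]) hFint
  -- `multivariateGaussian v S` is by definition the image of the standard Gaussian under `x ↦ v +
  -- √S x`, and `T` is this `√S`.
  change klDiv (f d) (multivariateGaussian v S) = _ at key
  rw [key, hF, integral_add c1 (n1.fun_neg.fun_add (q1.div_const 2)),
    integral_add n1.fun_neg (q1.div_const 2), integral_neg, integral_div, integral_div, integral_div, q2,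
    integral_norm_sq_stdGaussian, integral_const]
  congr 1
  simp [Matrix.mulVec_neg]
  ring

end Quadratic

end GaussianIS

namespace GaussianIS

open scoped RealInnerProductSpace MatrixOrder

/-! ### Moments of a probability measure dominated by `c • f` -/

section BoundedDensity

variable {d : ℕ} {ν : Measure (EuclideanSpace ℝ (Fin d))} {c : ℝ}

lemma integrable_of_le_smul (hν : ν ≤ ENNReal.ofReal c • f d)
    {h : EuclideanSpace ℝ (Fin d) → ℝ} (hh : Integrable h (f d)) : Integrable h ν :=
  (hh.smul_measure ENNReal.ofReal_ne_top).mono_measure hν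

lemma integral_le_of_le_smul (hc : 0 ≤ c) (hν : ν ≤ ENNReal.ofReal c • f d)
    {h : EuclideanSpace ℝ (Fin d) → ℝ} (hh : Integrable h (f d)) (h0 : ∀ x, 0 ≤ h x) :
    ∫ x, h x ∂ν ≤ c * ∫ x, h x ∂(f d) := by
  have := integral_mono_measure hν (.of_forall h0) (hh.smul_measure ENNReal.ofReal_ne_top)
  rwa [integral_smul_measure, ENNReal.toReal_ofReal hc, smul_eq_mul] at this

lemma sq_integral_le_integral_sq [IsProbabilityMeasure ν] {h : EuclideanSpace ℝ (Fin d) → ℝ}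
    (h1 : Integrable h ν) (h2 : Integrable (fun x => h x ^ 2) ν) :
    (∫ x, h x ∂ν) ^ 2 ≤ ∫ x, h x ^ 2 ∂ν := by
  have hm : MemLp h 2 ν := (memLp_two_iff_integrable_sq h1.aestronglyMeasurable).2 h2
  have := variance_nonneg h ν
  rw [variance_eq_sub hm] at this
  simpa using this

lemma integrable_inner_f (u : EuclideanSpace ℝ (Fin d)) : Integrable (fun x => ⟪u, x⟫) (f d) :=
  IsGaussian.integrable_id.const_inner u

lemma integrable_inner_sq_f (u : EuclideanSpace ℝ (Fin d)) :
    Integrable (fun x => ⟪u, x⟫ ^ 2) (f d) :=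
  ((IsGaussian.memLp_two_id (μ := f d)).const_inner u).integrable_sq

lemma integrable_id_of_le_smul (hν : ν ≤ ENNReal.ofReal c • f d) : Integrable (fun x => x) ν :=
  ((IsGaussian.integrable_id (μ := f d)).smul_measure ENNReal.ofReal_ne_top).mono_measure hν

lemma inner_integral_id (hν : ν ≤ ENNReal.ofReal c • f d) (u : EuclideanSpace ℝ (Fin d)) :
    ⟪u, ∫ x, x ∂ν⟫ = ∫ x, ⟪u, x⟫ ∂ν :=
  (integral_inner (integrable_id_of_le_smul hν) u).symm

variable [IsProbabilityMeasure ν]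

/-- Test the mean `m` against itself: `‖m‖⁴ = (∫ ⟪m, x⟫ ∂ν)² ≤ ∫ ⟪m, x⟫² ∂ν ≤ c ‖m‖²`. -/
lemma norm_integral_id_sq_le (hc : 0 < c) (hν : ν ≤ ENNReal.ofReal c • f d) :
    ‖∫ x, x ∂ν‖ ^ 2 ≤ c := by
  set m := ∫ x, x ∂ν with hm
  have h1 := sq_integral_le_integral_sq (integrable_of_le_smul hν (integrable_inner_f m))
    (integrable_of_le_smul hν (integrable_inner_sq_f m))
  have h2 := integral_le_of_le_smul hc.le hν (integrable_inner_sq_f m) fun x => sq_nonneg _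
  rw [integral_inner_sq_stdGaussian] at h2
  rw [← inner_integral_id hν, ← hm, real_inner_self_eq_norm_sq] at h1
  by_contra! h
  nlinarith

/-- The density is at most `1/√(2π) ≤ 1/2`, and the interval has length `2t`. -/
lemma gaussianReal_Ioo_le (m t : ℝ) :
    gaussianReal 0 1 (Set.Ioo (m - t) (m + t)) ≤ ENNReal.ofReal t := by
  rw [gaussianReal_apply 0 one_ne_zero]
  have hb : ∀ x, gaussianPDF 0 1 x ≤ ENNReal.ofReal (1 / 2) := by
    intro x
    refine ENNReal.ofReal_le_ofReal ?_
    have h2 : (2 : ℝ) ≤ √(2 * Real.pi) := by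
      rw [Real.le_sqrt (by norm_num) (by positivity)]
      have := Real.pi_gt_three
      linarith
    have h3 : Real.exp (-(x - 0) ^ 2 / (2 * (1 : NNReal))) ≤ 1 := by
      rw [Real.exp_le_one_iff, NNReal.coe_one]
      have := sq_nonneg (x - 0)
      linarith
    simp only [gaussianPDFReal, NNReal.coe_one, mul_one] at h3 ⊢
    calc _ ≤ (√(2 * Real.pi))⁻¹ * 1 := by gcongr
      _ ≤ 1 / 2 := by rw [mul_one, ← one_div]; gcongr
  calc ∫⁻ x in Set.Ioo (m - t) (m + t), gaussianPDF 0 1 x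
      ≤ ∫⁻ _ in Set.Ioo (m - t) (m + t), ENNReal.ofReal (1 / 2) := lintegral_mono fun x => hb x
    _ = ENNReal.ofReal t := by
        rw [setLIntegral_const, Real.volume_Ioo, ← ENNReal.ofReal_mul (by norm_num)]
        congr 1
        ring

/-- Anticoncentration: the slab of half-width `1/(2c)` around `m` has Gaussian mass at most
`1/(2c)`, hence `ν`-mass at most `1/2`. Markov's inequality on its complement gives `(1/(2c))² ·
1/2`. -/
lemma le_integral_sub_sq (hc : 0 < c) (hν : ν ≤ ENNReal.ofReal c • f d)
    {u : EuclideanSpace ℝ (Fin d)} (hu : ‖u‖ = 1) (m : ℝ) :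
    1 / (8 * c ^ 2) ≤ ∫ x, (⟪u, x⟫ - m) ^ 2 ∂ν := by
  have hI : Integrable (fun x : EuclideanSpace ℝ (Fin d) => (⟪u, x⟫ - m) ^ 2) ν := by
    have h : ∀ x : EuclideanSpace ℝ (Fin d), (⟪u, x⟫ - m) ^ 2 =
      ⟪u, x⟫ ^ 2 - 2 * m * ⟪u, x⟫ + m ^ 2 := fun x => by ring
    simp_rw [h]
    exact integrable_of_le_smul hν (((integrable_inner_sq_f u).sub
      ((integrable_inner_f u).const_mul _)).add (integrable_const _))
  have hM := mul_meas_ge_le_integral_of_nonneg (.of_forall fun x => sq_nonneg _) hI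
    ((1 / (2 * c)) ^ 2)
  refine le_trans ?_ hM
  set B : Set (EuclideanSpace ℝ (Fin d)) :=
    (fun x => ⟪u, x⟫) ⁻¹' Set.Ioo (m - 1 / (2 * c)) (m + 1 / (2 * c)) with hB
  have hBm : MeasurableSet B := measurableSet_Ioo.preimage (by fun_prop)
  have hBν : ν B ≤ ENNReal.ofReal (1 / 2) := by
    calc ν B ≤ ENNReal.ofReal c * f d B := by simpa using hν B
      _ ≤ ENNReal.ofReal c * ENNReal.ofReal (1 / (2 * c)) := by
        gcongr
        rw [hB, ← Measure.map_apply (by fun_prop) measurableSet_Ioo, map_inner_stdGaussian, hu]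
        simpa using gaussianReal_Ioo_le m (1 / (2 * c))
      _ = ENNReal.ofReal (1 / 2) := by
        rw [← ENNReal.ofReal_mul hc.le]
        congr 1
        field_simp
  have hBr : ν.real B ≤ 1 / 2 := ENNReal.toReal_le_of_le_ofReal (by norm_num) hBν
  have hcompl : 1 / 2 ≤ ν.real Bᶜ := by
    rw [probReal_compl_eq_one_sub hBm]
    linarith
  have hsub : Bᶜ ⊆ {x | (1 / (2 * c)) ^ 2 ≤ (⟪u, x⟫ - m) ^ 2} := by
    intro x hx
    by_contra hlt
    have hlt : (⟪u, x⟫ - m) ^ 2 < (1 / (2 * c)) ^ 2 := not_le.1 hlt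
    have := abs_lt_of_sq_lt_sq' hlt (by positivity)
    exact hx ⟨by linarith [this.1], by linarith [this.2]⟩
  have h3 : 1 / 2 ≤ ν.real {x | (1 / (2 * c)) ^ 2 ≤ (⟪u, x⟫ - m) ^ 2} :=
    hcompl.trans (measureReal_mono hsub)
  calc 1 / (8 * c ^ 2) = (1 / (2 * c)) ^ 2 * (1 / 2) := by field_simp; norm_num
    _ ≤ _ := by gcongr

lemma memLp_sq_sub_one_gaussianReal (t : ℝ) :
    MemLp (fun x : ℝ => t * (x ^ 2 - 1)) 2 (gaussianReal 0 1) := by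
  have h4 : Integrable (fun x : ℝ => x ^ 4) (gaussianReal 0 1) := by
    have := (memLp_id_gaussianReal (μ := 0) (v := 1) 4).integrable_norm_pow (by norm_num)
    simpa [(show Even 4 by decide).pow_abs] using this
  have h : MemLp (fun x : ℝ => x ^ 2) 2 (gaussianReal 0 1) := by
    rw [memLp_two_iff_integrable_sq (by fun_prop)]
    convert h4 using 2 with x
    ring
  exact (h.sub (memLp_const 1)).const_mul t

/-- The coordinates along `b` are independent standard Gaussians, so the variances add. The variance
constant need not be evaluated; only its independence of `d` matters. -/
lemma integral_sum_mul_sq_sub_one (b : OrthonormalBasis (Fin d) ℝ (EuclideanSpace ℝ (Fin d)))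
    (t : Fin d → ℝ) :
    Integrable (fun x => (∑ i, t i * (⟪b i, x⟫ ^ 2 - 1)) ^ 2) (f d) ∧
      ∫ x, (∑ i, t i * (⟪b i, x⟫ ^ 2 - 1)) ^ 2 ∂(f d) =
        Var[fun x => x ^ 2 - 1; gaussianReal 0 1] * ∑ i, t i ^ 2 := by
  have hmap : (f d).map (fun x i => ⟪b i, x⟫) = Measure.pi fun _ : Fin d => gaussianReal 0 1 := by
    rw [f, stdGaussian_eq_map_pi_orthonormalBasis b, Measure.map_map (by fun_prop)
      (by fun_prop)]
    convert Measure.map_id using 2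
    ext x i
    exact b.orthonormal.inner_right_fintype x i
  have hL : MemLp (∑ i, fun ω : Fin d → ℝ => t i * (ω i ^ 2 - 1)) 2
      (Measure.pi fun _ : Fin d => gaussianReal 0 1) := by
    refine memLp_finsetSum' _ fun i _ => ?_
    exact (memLp_sq_sub_one_gaussianReal (t i)).comp_measurePreserving (measurePreserving_eval _ i)
  have hv := variance_sum_pi (μ := fun _ : Fin d => gaussianReal 0 1)
    (X := fun i x => t i * (x ^ 2 - 1)) fun i => memLp_sq_sub_one_gaussianReal (t i)
  have hmean : (Measure.pi fun _ : Fin d => gaussianReal 0 1)[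
      ∑ i, fun ω : Fin d → ℝ => t i * (ω i ^ 2 - 1)] = 0 := by
    simp only [Finset.sum_apply]
    rw [integral_finsetSum]
    · refine Finset.sum_eq_zero fun i _ => ?_
      rw [integral_comp_eval (X := fun _ : Fin d => ℝ) (μ := fun _ => gaussianReal 0 1)
        (f := fun x : ℝ => t i * (x ^ 2 - 1)) (by fun_prop),
        integral_const_mul, integral_sub integrable_sq_gaussianReal (integrable_const _),
        integral_sq_gaussianReal]
      simp
    · intro i _
      exact ((memLp_sq_sub_one_gaussianReal (t i)).comp_measurePreserving
        (measurePreserving_eval _ i)).integrable one_le_two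
  rw [variance_of_integral_eq_zero hL.aestronglyMeasurable.aemeasurable hmean] at hv
  simp_rw [variance_const_mul] at hv
  rw [← Finset.sum_mul, mul_comm] at hv
  have hI := hL.integrable_sq
  rw [← hmap] at hv hI
  rw [integral_map (by fun_prop) (Measurable.aestronglyMeasurable (by fun_prop))] at hv
  refine ⟨?_, ?_⟩
  · have := hI.comp_measurable (by fun_prop : Measurable fun x i => ⟪b i, x⟫)
    simpa [Function.comp_def] using this
  · simpa using hv

/-- A Bessel-type inequality for the second moments along an orthonormal basis. -/
lemma sum_sq_integral_sq_sub_one_le (hc : 0 < c) (hν : ν ≤ ENNReal.ofReal c • f d)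
    (b : OrthonormalBasis (Fin d) ℝ (EuclideanSpace ℝ (Fin d))) :
    ∑ i, (∫ x, ⟪b i, x⟫ ^ 2 ∂ν - 1) ^ 2 ≤
      c * Var[fun x => x ^ 2 - 1; gaussianReal 0 1] := by
  -- Duality: with these weights, `∑ tᵢ (⟪bᵢ, x⟫² - 1)` has `ν`-mean `∑ tᵢ²`, and Cauchy–Schwarz
  -- gives `(∑ tᵢ²)² ≤ c Var ∑ tᵢ²`.
  set t : Fin d → ℝ := fun i => ∫ x, ⟪b i, x⟫ ^ 2 ∂ν - 1 with ht
  obtain ⟨hI, hE⟩ := integral_sum_mul_sq_sub_one b t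
  have hi : ∀ i, Integrable (fun x => t i * (⟪b i, x⟫ ^ 2 - 1)) ν := fun i =>
    ((integrable_of_le_smul hν (integrable_inner_sq_f (b i))).sub (integrable_const _)).const_mul _
  have h1 := sq_integral_le_integral_sq (integrable_finsetSum _ fun i _ => hi i)
    (integrable_of_le_smul hν hI)
  have h2 := integral_le_of_le_smul hc.le hν hI fun x => sq_nonneg _
  have h3 : ∫ x, ∑ i, t i * (⟪b i, x⟫ ^ 2 - 1) ∂ν = ∑ i, t i ^ 2 := by
    rw [integral_finsetSum _ fun i _ => hi i]
    refine Finset.sum_congr rfl fun i _ => ?_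
    rw [integral_const_mul, integral_sub (integrable_of_le_smul hν (integrable_inner_sq_f (b i)))
      (integrable_const _)]
    simp [ht, sq]
  rw [h3] at h1
  rw [hE] at h2
  have hS : 0 ≤ ∑ i, t i ^ 2 := Finset.sum_nonneg fun i _ => sq_nonneg _
  have hV : 0 ≤ Var[fun x : ℝ => x ^ 2 - 1; gaussianReal 0 1] := variance_nonneg _ _
  change ∑ i, t i ^ 2 ≤ _
  by_contra! h
  nlinarith [mul_nonneg hc.le hV]

end BoundedDensity

/-! ### Mean and covariance spectrum of the conditioned Gaussian -/

section Conditioning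

variable {d : ℕ} {A : Set (EuclideanSpace ℝ (Fin d))} {p : ℝ}

lemma isProbabilityMeasure_condLaw (hp : 0 < p) (hpA : ENNReal.ofReal p ≤ f d A) :
    IsProbabilityMeasure (condLaw A) :=
  cond_isProbabilityMeasure ((ENNReal.ofReal_pos.2 hp).trans_le hpA).ne'

lemma condLaw_le (hp : 0 < p) (hpA : ENNReal.ofReal p ≤ f d A) :
    condLaw A ≤ ENNReal.ofReal p⁻¹ • f d := by
  rw [condLaw, ProbabilityTheory.cond, ENNReal.ofReal_inv_of_pos hp]
  intro s
  simp only [Measure.smul_apply, smul_eq_mul]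
  gcongr
  exact Measure.restrict_le_self

lemma dotProduct_covA_mulVec (hp : 0 < p) (hpA : ENNReal.ofReal p ≤ f d A)
    (u : EuclideanSpace ℝ (Fin d)) :
    u.ofLp ⬝ᵥ (covA A).mulVec u.ofLp = ∫ x, ⟪u, x⟫ ^ 2 ∂(condLaw A) - ⟪u, meanA A⟫ ^ 2 := by
  have hν := condLaw_le hp hpA
  have hq : ∀ x : EuclideanSpace ℝ (Fin d), ⟪u, x⟫ ^ 2 = ∑ i, ∑ j, u i * u j * (x i * x j) := by
    intro x
    simp only [PiLp.inner_apply, Real.inner_apply, sq, Finset.sum_mul_sum]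
    exact Finset.sum_congr rfl fun i _ => Finset.sum_congr rfl fun j _ => by ring
  have hI := fun i j => (integrable_of_le_smul hν
    (integral_coord_mul_coord_stdGaussian i j).1).const_mul (u i * u j)
  simp_rw [hq]
  rw [integral_finsetSum _ fun i _ => integrable_finsetSum _ fun j _ => hI i j]
  simp_rw [integral_finsetSum _ fun j _ => hI _ j, integral_const_mul, ← Finset.sum_sub_distrib,
    dotProduct, Matrix.mulVec, dotProduct, Finset.mul_sum, covA, Matrix.of_apply]
  exact Finset.sum_congr rfl fun i _ => Finset.sum_congr rfl fun j _ => by ring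

lemma isHermitian_covA : (covA A).IsHermitian := by
  ext i j
  simp [covA, mul_comm]

lemma le_dotProduct_covA_mulVec (hp : 0 < p) (hpA : ENNReal.ofReal p ≤ f d A)
    {u : EuclideanSpace ℝ (Fin d)} (hu : ‖u‖ = 1) :
    p ^ 2 / 8 ≤ u.ofLp ⬝ᵥ (covA A).mulVec u.ofLp := by
  have hν := condLaw_le hp hpA
  have := isProbabilityMeasure_condLaw hp hpA
  have h := le_integral_sub_sq (inv_pos.2 hp) hν hu ⟪u, meanA A⟫
  have hm : ∫ x, ⟪u, x⟫ ∂(condLaw A) = ⟪u, meanA A⟫ := (inner_integral_id hν u).symm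
  have h1 := integrable_of_le_smul hν (integrable_inner_sq_f u)
  have h2 := integrable_of_le_smul hν (integrable_inner_f u)
  have h3 : ∫ x, (⟪u, x⟫ - ⟪u, meanA A⟫) ^ 2 ∂(condLaw A) =
      ∫ x, ⟪u, x⟫ ^ 2 ∂(condLaw A) - ⟪u, meanA A⟫ ^ 2 := by
    have e : ∀ x : EuclideanSpace ℝ (Fin d), (⟪u, x⟫ - ⟪u, meanA A⟫) ^ 2 =
      ⟪u, x⟫ ^ 2 - 2 * ⟪u, meanA A⟫ * ⟪u, x⟫ + ⟪u, meanA A⟫ ^ 2 := fun x => by ring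
    have h4 : Integrable (fun x : EuclideanSpace ℝ (Fin d) =>
        ⟪u, x⟫ ^ 2 - 2 * ⟪u, meanA A⟫ * ⟪u, x⟫) (condLaw A) := h1.sub (h2.const_mul _)
    simp_rw [e]
    rw [integral_add h4 (integrable_const _), integral_sub h1 (h2.const_mul _), integral_const_mul,
      hm]
    simp
    ring
  rw [dotProduct_covA_mulVec hp hpA, ← h3]
  refine le_trans (le_of_eq ?_) h
  field_simp

lemma eigenvalues_covA_eq (hp : 0 < p) (hpA : ENNReal.ofReal p ≤ f d A) (i : Fin d) :
    (isHermitian_covA (A := A)).eigenvalues i =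
      ∫ x, ⟪(isHermitian_covA (A := A)).eigenvectorBasis i, x⟫ ^ 2 ∂(condLaw A) -
        ⟪(isHermitian_covA (A := A)).eigenvectorBasis i, meanA A⟫ ^ 2 := by
  rw [← dotProduct_covA_mulVec hp hpA, isHermitian_covA.eigenvalues_eq i]
  rfl

lemma le_eigenvalues_covA (hp : 0 < p) (hpA : ENNReal.ofReal p ≤ f d A) (i : Fin d) :
    p ^ 2 / 8 ≤ (isHermitian_covA (A := A)).eigenvalues i := by
  rw [eigenvalues_covA_eq hp hpA, ← dotProduct_covA_mulVec hp hpA]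
  exact le_dotProduct_covA_mulVec hp hpA (OrthonormalBasis.norm_eq_one _ i)

lemma norm_meanA_sq_le (hp : 0 < p) (hpA : ENNReal.ofReal p ≤ f d A) : ‖meanA A‖ ^ 2 ≤ p⁻¹ := by
  have := isProbabilityMeasure_condLaw hp hpA
  exact norm_integral_id_sq_le (inv_pos.2 hp) (condLaw_le hp hpA)

/-- Along the eigenbasis, `λᵢ - 1` is the centred second moment minus `⟪bᵢ, μ_A⟫²`. The former is
square-summable by the Bessel-type bound, and the squares of the latter sum to at most `‖μ_A‖⁴`. -/
lemma sum_sq_eigenvalues_covA_sub_one_le (hp : 0 < p) (hpA : ENNReal.ofReal p ≤ f d A) :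
    ∑ i, ((isHermitian_covA (A := A)).eigenvalues i - 1) ^ 2 ≤
      2 * (p⁻¹ * Var[fun x => x ^ 2 - 1; gaussianReal 0 1]) + 2 * (p⁻¹) ^ 2 := by
  have := isProbabilityMeasure_condLaw hp hpA
  set b := (isHermitian_covA (A := A)).eigenvectorBasis with hb
  have h1 := sum_sq_integral_sq_sub_one_le (inv_pos.2 hp) (condLaw_le hp hpA) b
  have h2 : ∑ i, (⟪b i, meanA A⟫ ^ 2) ^ 2 ≤ (p⁻¹) ^ 2 := by
    calc ∑ i, (⟪b i, meanA A⟫ ^ 2) ^ 2 ≤ (∑ i, ⟪b i, meanA A⟫ ^ 2) ^ 2 :=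
          Finset.sum_sq_le_sq_sum_of_nonneg fun i _ => sq_nonneg _
      _ ≤ (p⁻¹) ^ 2 := by
          rw [b.sum_sq_inner_right]
          exact pow_le_pow_left₀ (by positivity) (norm_meanA_sq_le hp hpA) 2
  calc ∑ i, ((isHermitian_covA (A := A)).eigenvalues i - 1) ^ 2
      ≤ ∑ i, (2 * (∫ x, ⟪b i, x⟫ ^ 2 ∂(condLaw A) - 1) ^ 2 +
          2 * (⟪b i, meanA A⟫ ^ 2) ^ 2) := by
        refine Finset.sum_le_sum fun i _ => ?_
        rw [eigenvalues_covA_eq hp hpA, ← hb]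
        nlinarith [sq_nonneg (∫ x, ⟪b i, x⟫ ^ 2 ∂(condLaw A) - 1 + ⟪b i, meanA A⟫ ^ 2)]
    _ ≤ _ := by
        rw [Finset.sum_add_distrib, ← Finset.mul_sum, ← Finset.mul_sum]
        gcongr

lemma posDef_covA (hp : 0 < p) (hpA : ENNReal.ofReal p ≤ f d A) : (covA A).PosDef :=
  isHermitian_covA.posDef_iff_eigenvalues_pos.2 fun i =>
    (by positivity : 0 < p ^ 2 / 8).trans_le (le_eigenvalues_covA hp hpA i)

end Conditioning

end GaussianIS

namespace GaussianIS

open scoped RealInnerProductSpace MatrixOrder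
open Matrix (gram)

/-! ### Factorization of the covariance and standardization -/

section Factorization

variable {d : ℕ}

/-- `B = U √D` from the spectral theorem. Unlike the symmetric root, it makes `BᵀB` diagonal, so
that the trace term of the divergence involves only diagonal entries of `G⁻¹`. -/
lemma exists_factorization {S : Matrix (Fin d) (Fin d) ℝ} (hS : S.PosDef) :
    ∃ B : Matrix (Fin d) (Fin d) ℝ, B * B.transpose = S ∧
      B.transpose * B = Matrix.diagonal hS.1.eigenvalues := by
  set U : Matrix (Fin d) (Fin d) ℝ := (hS.1.eigenvectorUnitary).1 with hU
  have hUU : U.transpose * U = 1 := by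
    have := Unitary.coe_star_mul_self hS.1.eigenvectorUnitary
    rwa [Matrix.star_eq_conjTranspose, Matrix.conjTranspose_eq_transpose_of_trivial] at this
  set D : Matrix (Fin d) (Fin d) ℝ := Matrix.diagonal fun i => √(hS.1.eigenvalues i) with hD
  have hDD : D * D = Matrix.diagonal hS.1.eigenvalues := by
    rw [hD, Matrix.diagonal_mul_diagonal]
    congr 1 with i
    exact Real.mul_self_sqrt (hS.eigenvalues_pos i).le
  have hDt : D.transpose = D := Matrix.diagonal_transpose _
  refine ⟨U * D, ?_, ?_⟩
  · have h := hS.1.spectral_theorem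
    rw [Unitary.conjStarAlgAut_apply] at h
    conv_rhs => rw [h]
    rw [Matrix.transpose_mul, hDt, Matrix.mul_assoc, ← Matrix.mul_assoc D, hDD, ← Matrix.mul_assoc,
      Matrix.star_eq_conjTranspose, Matrix.conjTranspose_eq_transpose_of_trivial]
    rfl
  · rw [Matrix.transpose_mul, hDt, Matrix.mul_assoc, ← Matrix.mul_assoc _ U, hUU, Matrix.one_mul,
      hDD]

lemma map_toEuclideanCLM_stdGaussian {O : Matrix (Fin d) (Fin d) ℝ} (hO : O * O.transpose = 1) :
    (f d).map (Matrix.toEuclideanCLM (𝕜 := ℝ) O) = f d := by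
  have : IsProbabilityMeasure ((f d).map (Matrix.toEuclideanCLM (𝕜 := ℝ) O)) :=
    Measure.isProbabilityMeasure_map (Measurable.aemeasurable (by fun_prop))
  apply Measure.ext_of_charFun
  ext t
  have hin : ∀ x, ⟪Matrix.toEuclideanCLM (𝕜 := ℝ) O x, t⟫ =
      ⟪x, Matrix.toEuclideanCLM (𝕜 := ℝ) O.transpose t⟫ := by
    intro x
    rw [real_inner_comm, Matrix.inner_toEuclideanCLM, Matrix.inner_toEuclideanCLM, Matrix.dotProduct_mulVec,
      ← Matrix.mulVec_transpose, dotProduct_comm]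
  have hn : ‖Matrix.toEuclideanCLM (𝕜 := ℝ) O.transpose t‖ = ‖t‖ := by
    rw [← sq_eq_sq₀ (norm_nonneg _) (norm_nonneg _), ← real_inner_self_eq_norm_sq,
      ← real_inner_self_eq_norm_sq, ← hin, ← ContinuousLinearMap.comp_apply,
      ← ContinuousLinearMap.mul_def, ← map_mul, hO, map_one, one_apply_eq_self]
  have h := charFun_stdGaussian (Matrix.toEuclideanCLM (𝕜 := ℝ) O.transpose t)
  rw [hn, charFun_apply] at h
  rw [charFun_apply, integral_map (Measurable.aemeasurable (by fun_prop)) (by fun_prop),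
    charFun_stdGaussian, ← h]
  simp_rw [hin]

/-- Standardization of a nondegenerate Gaussian through any factor of its covariance matrix. -/
lemma map_standardize_multivariateGaussian {S B : Matrix (Fin d) (Fin d) ℝ} (hS : S.PosDef)
    (hB : B * B.transpose = S) (v : EuclideanSpace ℝ (Fin d)) :
    (multivariateGaussian v S).map (fun y => Matrix.toEuclideanCLM (𝕜 := ℝ) B⁻¹ (y - v)) =
      f d := by
  have hBu : IsUnit B.det := by
    refine isUnit_iff_ne_zero.2 fun h => hS.det_pos.ne' ?_
    rw [← hB, Matrix.det_mul, h, zero_mul]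
  set R := CFC.sqrt S with hR
  have hRR : R * R = S := CFC.sqrt_mul_sqrt_self _ hS.posSemidef.nonneg
  have hRs : R.transpose = R := by
    have := (CFC.sqrt_nonneg S).isSelfAdjoint
    rw [isSelfAdjoint_iff, Matrix.star_eq_conjTranspose] at this
    simpa using this
  -- Two square roots of the same matrix differ by an orthogonal factor, which leaves the standard
  -- Gaussian invariant.
  have hO : (B⁻¹ * R) * (B⁻¹ * R).transpose = 1 := by
    rw [Matrix.transpose_mul, hRs, Matrix.mul_assoc, ← Matrix.mul_assoc R, hRR, ← hB,
      Matrix.mul_assoc B, ← Matrix.transpose_mul, Matrix.nonsing_inv_mul _ hBu,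
      Matrix.transpose_one, Matrix.mul_one, Matrix.nonsing_inv_mul _ hBu]
  rw [multivariateGaussian, Measure.map_map (by fun_prop) (by fun_prop)]
  conv_rhs => rw [← map_toEuclideanCLM_stdGaussian hO]
  congr 1
  ext1 x
  simp only [Function.comp_apply, add_sub_cancel_left]
  rw [map_mul, ContinuousLinearMap.mul_def, ContinuousLinearMap.comp_apply]

end Factorization

/-! ### Rotation of the sample space -/

section Rotation

variable {d m n : ℕ}

/-- The vector of `i`-th coordinates of a sample. -/
noncomputable def coordRow (z : Fin n → EuclideanSpace ℝ (Fin d)) (i : Fin d) : EuclideanSpace ℝ (Fin n) :=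
  WithLp.toLp 2 fun k => z k i

/-- The coordinates of a sample along the first vector of an orthonormal basis of the sample
space. -/
noncomputable def rotHead (b : OrthonormalBasis (Fin (m + 1)) ℝ (EuclideanSpace ℝ (Fin n)))
    (z : Fin n → EuclideanSpace ℝ (Fin d)) : EuclideanSpace ℝ (Fin d) :=
  WithLp.toLp 2 fun i => ⟪b 0, coordRow z i⟫

/-- The coordinates of a sample along the remaining vectors of an orthonormal basis of the sample
space. -/
noncomputable def rotTail (b : OrthonormalBasis (Fin (m + 1)) ℝ (EuclideanSpace ℝ (Fin n)))
    (z : Fin n → EuclideanSpace ℝ (Fin d)) (i : Fin d) : EuclideanSpace ℝ (Fin m) :=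
  WithLp.toLp 2 fun j => ⟪b j.succ, coordRow z i⟫

lemma inner_rotTail (b : OrthonormalBasis (Fin (m + 1)) ℝ (EuclideanSpace ℝ (Fin n)))
    (z : Fin n → EuclideanSpace ℝ (Fin d)) (i j : Fin d) :
    ⟪rotTail b z i, rotTail b z j⟫ = ⟪coordRow z i, coordRow z j⟫ -
      rotHead b z i * rotHead b z j := by
  have h := b.sum_inner_mul_inner (coordRow z i) (coordRow z j)
  rw [Fin.sum_univ_succ] at h
  have h' : ⟪rotTail b z i, rotTail b z j⟫ =
      ∑ k : Fin m, ⟪coordRow z i, b k.succ⟫ * ⟪b k.succ, coordRow z j⟫ := by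
    simp [rotTail, PiLp.inner_apply, mul_comm]
  have h0 : rotHead b z i * rotHead b z j = ⟪coordRow z i, b 0⟫ * ⟪b 0, coordRow z j⟫ := by
    simp [rotHead, real_inner_comm]
  rw [h', h0, ← h]
  ring

lemma rotHead_add (b : OrthonormalBasis (Fin (m + 1)) ℝ (EuclideanSpace ℝ (Fin n)))
    (x y : Fin n → EuclideanSpace ℝ (Fin d)) : rotHead b (x + y) = rotHead b x + rotHead b y := by
  ext i
  exact inner_add_right _ (coordRow x i) (coordRow y i)

lemma rotHead_smul (b : OrthonormalBasis (Fin (m + 1)) ℝ (EuclideanSpace ℝ (Fin n))) (c : ℝ)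
    (x : Fin n → EuclideanSpace ℝ (Fin d)) : rotHead b (c • x) = c • rotHead b x := by
  ext i
  exact real_inner_smul_right _ (coordRow x i) c

lemma rotTail_add (b : OrthonormalBasis (Fin (m + 1)) ℝ (EuclideanSpace ℝ (Fin n)))
    (x y : Fin n → EuclideanSpace ℝ (Fin d)) : rotTail b (x + y) = rotTail b x + rotTail b y := by
  ext i j
  exact inner_add_right _ (coordRow x i) (coordRow y i)

lemma rotTail_smul (b : OrthonormalBasis (Fin (m + 1)) ℝ (EuclideanSpace ℝ (Fin n))) (c : ℝ)
    (x : Fin n → EuclideanSpace ℝ (Fin d)) : rotTail b (c • x) = c • rotTail b x := by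
  ext i j
  exact real_inner_smul_right _ (coordRow x i) c

lemma norm_rotation_sq (b : OrthonormalBasis (Fin (m + 1)) ℝ (EuclideanSpace ℝ (Fin n)))
    (z : Fin n → EuclideanSpace ℝ (Fin d)) :
    ‖rotHead b z‖ ^ 2 + ∑ i, ‖rotTail b z i‖ ^ 2 = ∑ k, ‖z k‖ ^ 2 := by
  simp_rw [← real_inner_self_eq_norm_sq (rotTail b z _), inner_rotTail]
  rw [EuclideanSpace.real_norm_sq_eq, ← Finset.sum_add_distrib]
  simp_rw [EuclideanSpace.real_norm_sq_eq (z _)]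
  rw [Finset.sum_comm]
  refine Finset.sum_congr rfl fun i _ => ?_
  rw [real_inner_self_eq_norm_sq, EuclideanSpace.real_norm_sq_eq (coordRow z i)]
  simp only [coordRow]
  ring

/-- An orthogonal change of variables in the sample space turns an i.i.d. standard Gaussian sample
into an independent pair of standard Gaussian data. -/
lemma hasLaw_rotation (b : OrthonormalBasis (Fin (m + 1)) ℝ (EuclideanSpace ℝ (Fin n))) :
    HasLaw (fun z => (rotHead b z, rotTail b z))
      ((f d).prod (Measure.pi fun _ : Fin d => stdGaussian (EuclideanSpace ℝ (Fin m))))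
      (Measure.pi fun _ : Fin n => f d) := by
  have hn : n = m + 1 := by
    have := Module.finrank_eq_card_basis b.toBasis
    simpa using this
  let H := PiLp 2 fun _ : Fin n => EuclideanSpace ℝ (Fin d)
  let H₁ := PiLp 2 fun _ : Fin d => EuclideanSpace ℝ (Fin m)
  let H' := WithLp 2 (EuclideanSpace ℝ (Fin d) × H₁)
  -- On the `ℓ²` sums the rotation is a linear isometry between spaces of equal dimension, so it
  -- carries one standard Gaussian to the other. Independence of head and tail is the product form
  -- of the target.
  let T₀ : H →ₗ[ℝ] H' :=
    { toFun := fun z => WithLp.toLp 2 (rotHead b z.ofLp, WithLp.toLp 2 (rotTail b z.ofLp))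
      map_add' := fun x y => congrArg (WithLp.toLp 2) (Prod.ext (rotHead_add b x.ofLp y.ofLp)
        (congrArg (WithLp.toLp 2) (rotTail_add b x.ofLp y.ofLp)))
      map_smul' := fun c x => congrArg (WithLp.toLp 2) (Prod.ext (rotHead_smul b c x.ofLp)
        (congrArg (WithLp.toLp 2) (rotTail_smul b c x.ofLp))) }
  let T₁ : H →ₗᵢ[ℝ] H' := ⟨T₀, fun z => by
    rw [← sq_eq_sq₀ (norm_nonneg _) (norm_nonneg _), WithLp.prod_norm_sq_eq_of_L2,
      PiLp.norm_sq_eq_of_L2 _ z]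
    rw [← norm_rotation_sq b]
    congr 1
    exact PiLp.norm_sq_eq_of_L2 _ _⟩
  have hfin : Module.finrank ℝ H = Module.finrank ℝ H' := by
    have e1 : Module.finrank ℝ H = n * d := by
      rw [(WithLp.linearEquiv 2 ℝ (Fin n → EuclideanSpace ℝ (Fin d))).finrank_eq,
        Module.finrank_pi_fintype]
      simp
    have e2 : Module.finrank ℝ H₁ = d * m := by
      rw [(WithLp.linearEquiv 2 ℝ (Fin d → EuclideanSpace ℝ (Fin m))).finrank_eq,
        Module.finrank_pi_fintype]
      simp
    have e3 : Module.finrank ℝ H' = d + d * m := by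
      rw [(WithLp.linearEquiv 2 ℝ (EuclideanSpace ℝ (Fin d) × H₁)).finrank_eq,
        Module.finrank_prod, e2]
      simp
    rw [e1, e3, hn]
    ring
  let T := T₁.toLinearIsometryEquiv hfin
  have h1 : (stdGaussian H).map T = stdGaussian H' := stdGaussian_map T
  have h2 := map_toLp_pi_stdGaussian (E := EuclideanSpace ℝ (Fin d)) (ι := Fin n)
  have h3 := map_toLp_pi_stdGaussian (E := EuclideanSpace ℝ (Fin m)) (ι := Fin d)
  have h4 := map_toLp_prod_stdGaussian (E := EuclideanSpace ℝ (Fin d)) (F := H₁)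
  have hT : (fun z => (rotHead b z, rotTail b z)) =
      (Prod.map id WithLp.ofLp) ∘ WithLp.ofLp ∘ T ∘ WithLp.toLp 2 := rfl
  have hTm : Measurable T := T.continuous.measurable
  refine ⟨?_, ?_⟩
  · rw [hT]
    exact Measurable.aemeasurable (by fun_prop)
  · rw [hT, ← Measure.map_map (by fun_prop) (by fun_prop),
      ← Measure.map_map (by fun_prop) (by fun_prop), ← Measure.map_map (by fun_prop) (by fun_prop),
      h2, h1, ← h4, Measure.map_map (by fun_prop) (by fun_prop), Measure.map_map (by fun_prop)
      (by fun_prop)]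
    change Measure.map (Prod.map id WithLp.ofLp) _ = _
    rw [← h3, ← Measure.map_prod_map _ _ (by fun_prop) (by fun_prop),
      Measure.map_id, Measure.map_map (by fun_prop) (by fun_prop)]
    exact congrArg _ Measure.map_id

end Rotation

end GaussianIS

namespace GaussianIS

open scoped RealInnerProductSpace MatrixOrder
open Matrix (gram)

/-! ### Sample mean and covariance in rotated coordinates -/

section SampleStatistics

variable {d m n : ℕ}

lemma sampleMean_apply (y : Fin n → EuclideanSpace ℝ (Fin d)) (i : Fin d) :
    sampleMean y i = (1 / (n : ℝ)) * ∑ k, y k i := by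
  simp [sampleMean]

lemma sampleMean_affine (hn : n ≠ 0) (B : Matrix (Fin d) (Fin d) ℝ)
    (v : EuclideanSpace ℝ (Fin d)) (z : Fin n → EuclideanSpace ℝ (Fin d)) :
    sampleMean (fun k => v + Matrix.toEuclideanCLM (𝕜 := ℝ) B (z k)) =
      v + Matrix.toEuclideanCLM (𝕜 := ℝ) B (sampleMean z) := by
  have hn' : (n : ℝ) ≠ 0 := by exact_mod_cast hn
  rw [sampleMean, sampleMean, map_smul, map_sum, Finset.sum_add_distrib, Finset.sum_const,
    Finset.card_univ, Fintype.card_fin, smul_add, ← Nat.cast_smul_eq_nsmul ℝ, smul_smul,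
    one_div_mul_cancel hn', one_smul]

lemma sampleCov_apply (hn : n ≠ 0) (y : Fin n → EuclideanSpace ℝ (Fin d)) (i j : Fin d) :
    sampleCov y i j =
      (1 / (n : ℝ)) * ∑ k, (y k - sampleMean y) i * (y k - sampleMean y) j := by
  have hn' : (n : ℝ) ≠ 0 := by exact_mod_cast hn
  have hs : ∀ i, ∑ k, y k i = n * sampleMean y i := fun i => by
    rw [sampleMean_apply]
    field_simp
  have h : ∀ k, (y k - sampleMean y) i * (y k - sampleMean y) j = y k i * y k j -
      sampleMean y j * y k i - sampleMean y i * y k j + sampleMean y i * sampleMean y j := by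
    intro k
    simp only [PiLp.sub_apply]
    ring
  simp_rw [h]
  rw [Finset.sum_add_distrib, Finset.sum_sub_distrib, Finset.sum_sub_distrib, ← Finset.mul_sum,
    ← Finset.mul_sum, hs, hs, Finset.sum_const, Finset.card_univ, Fintype.card_fin, nsmul_eq_mul,
    sampleCov, Matrix.of_apply]
  field_simp
  ring

lemma sampleCov_affine (hn : n ≠ 0) (B : Matrix (Fin d) (Fin d) ℝ)
    (v : EuclideanSpace ℝ (Fin d)) (z : Fin n → EuclideanSpace ℝ (Fin d)) :
    sampleCov (fun k => v + Matrix.toEuclideanCLM (𝕜 := ℝ) B (z k)) =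
      B * sampleCov z * B.transpose := by
  ext i j
  rw [sampleCov_apply hn, sampleMean_affine hn]
  have h : ∀ k, v + Matrix.toEuclideanCLM (𝕜 := ℝ) B (z k) -
      (v + Matrix.toEuclideanCLM (𝕜 := ℝ) B (sampleMean z)) =
      Matrix.toEuclideanCLM (𝕜 := ℝ) B (z k - sampleMean z) := fun k => by
    rw [map_sub]
    abel
  have hL : ∀ x : EuclideanSpace ℝ (Fin d), Matrix.toEuclideanCLM (𝕜 := ℝ) B x i *
      Matrix.toEuclideanCLM (𝕜 := ℝ) B x j = ∑ c, ∑ a, B i a * (x a * x c) * B j c := by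
    intro x
    rw [Matrix.ofLp_toEuclideanCLM, Matrix.mulVec, Matrix.mulVec, dotProduct, dotProduct,
      Finset.sum_mul_sum, Finset.sum_comm]
    exact Finset.sum_congr rfl fun c _ => Finset.sum_congr rfl fun a _ => by ring
  simp_rw [h, hL, Matrix.mul_apply, Matrix.transpose_apply, sampleCov_apply hn, Finset.sum_mul]
  rw [Finset.sum_comm, Finset.mul_sum]
  refine Finset.sum_congr rfl fun c _ => ?_
  rw [Finset.sum_comm, Finset.mul_sum]
  refine Finset.sum_congr rfl fun a _ => ?_
  rw [← Finset.sum_mul, ← Finset.mul_sum]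
  ring

/-- The first coordinate along such a basis is `√n` times the sample mean; the other `n - 1`
coordinates carry the sample covariance. -/
lemma exists_orthonormalBasis_head_const (m : ℕ) :
    ∃ b : OrthonormalBasis (Fin (m + 1)) ℝ (EuclideanSpace ℝ (Fin (m + 1))),
      b 0 = WithLp.toLp 2 fun _ => 1 / √((m + 1 : ℕ) : ℝ) := by
  set e : EuclideanSpace ℝ (Fin (m + 1)) := WithLp.toLp 2 fun _ => 1 / √((m + 1 : ℕ) : ℝ) with he
  have hnorm : ‖e‖ = 1 := by
    rw [← sq_eq_sq₀ (norm_nonneg _) zero_le_one, EuclideanSpace.real_norm_sq_eq, he]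
    have : (m + 1 : ℝ) ≠ 0 := by positivity
    simp [Real.sq_sqrt (by positivity : (0 : ℝ) ≤ m + 1), mul_inv_cancel₀ this]
  have ho : Orthonormal ℝ (({0} : Set (Fin (m + 1))).domRestrict fun _ => e) := by
    refine ⟨fun _ => hnorm, fun i j hij => (hij (Subsingleton.elim _ _)).elim⟩
  obtain ⟨b, hb⟩ := ho.exists_orthonormalBasis_extension_of_card_eq (by simp)
  exact ⟨b, hb 0 rfl⟩

lemma sampleMean_eq_rotHead
    {b : OrthonormalBasis (Fin (m + 1)) ℝ (EuclideanSpace ℝ (Fin n))}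
    (hb : b 0 = WithLp.toLp 2 fun _ => 1 / √(n : ℝ)) (z : Fin n → EuclideanSpace ℝ (Fin d)) :
    sampleMean z = (1 / √(n : ℝ)) • rotHead b z := by
  ext i
  have hs : (1 / √(n : ℝ)) * (1 / √(n : ℝ)) = 1 / n := by
    rw [one_div_mul_one_div, Real.mul_self_sqrt (Nat.cast_nonneg n)]
  rw [sampleMean_apply, PiLp.smul_apply, rotHead, hb]
  simp only [PiLp.inner_apply, coordRow, Real.inner_apply, smul_eq_mul]
  rw [← hs, Finset.mul_sum, Finset.mul_sum]
  refine Finset.sum_congr rfl fun k _ => ?_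
  ring

lemma sampleCov_eq_gram_rotTail
    {b : OrthonormalBasis (Fin (m + 1)) ℝ (EuclideanSpace ℝ (Fin n))}
    (hb : b 0 = WithLp.toLp 2 fun _ => 1 / √(n : ℝ)) (z : Fin n → EuclideanSpace ℝ (Fin d)) :
    sampleCov z = (1 / (n : ℝ)) • gram ℝ (rotTail b z) := by
  ext i j
  have hs : (1 / √(n : ℝ)) * (1 / √(n : ℝ)) = 1 / n := by
    rw [one_div_mul_one_div, Real.mul_self_sqrt (Nat.cast_nonneg n)]
  rw [Matrix.smul_apply, Matrix.gram_apply, inner_rotTail, sampleCov, Matrix.of_apply,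
    sampleMean_eq_rotHead hb]
  have : ⟪coordRow z i, coordRow z j⟫ = ∑ k, z k i * z k j := by
    simp [PiLp.inner_apply, coordRow, mul_comm]
  rw [this, PiLp.smul_apply, PiLp.smul_apply, smul_eq_mul, smul_eq_mul, smul_eq_mul, mul_sub,
    mul_mul_mul_comm, hs]

end SampleStatistics

/-! ### The divergence as a function of the rotated sample -/

section Divergence

variable {d m n : ℕ}

lemma log_det_le_trace_sub {A : Matrix (Fin d) (Fin d) ℝ} (hA : A.PosDef) :
    Real.log A.det ≤ A.trace - d := by
  rw [hA.1.det_eq_prod_eigenvalues, hA.1.trace_eq_sum_eigenvalues]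
  simp only [RCLike.ofReal_real_eq_id, id]
  rw [Real.log_prod fun i _ => (hA.eigenvalues_pos i).ne']
  calc ∑ i, Real.log (hA.1.eigenvalues i) ≤ ∑ i, (hA.1.eigenvalues i - 1) :=
        Finset.sum_le_sum fun i _ => Real.log_le_sub_one_of_pos (hA.eigenvalues_pos i)
    _ = _ := by simp

/-- Ensures that `ENNReal.ofReal` does not truncate the closed form of the divergence. -/
lemma gaussianKL_nonneg {A : Matrix (Fin d) (Fin d) ℝ} (hA : A.PosDef) (v : Fin d → ℝ) :
    0 ≤ (Real.log A.det + A⁻¹.trace - d + v ⬝ᵥ A⁻¹.mulVec v) / 2 := by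
  have h1 := log_det_le_trace_sub hA.inv
  rw [Matrix.det_nonsing_inv, Ring.inverse_eq_inv', Real.log_inv] at h1
  have h2 : 0 ≤ v ⬝ᵥ A⁻¹.mulVec v := by simpa using hA.inv.posSemidef.dotProduct_mulVec_nonneg v
  linarith

/-- The Kullback–Leibler divergence of the standard Gaussian with respect to the fitted Gaussian, in
rotated coordinates: `ld` is the log-determinant of the true covariance, `lam` its eigenvalues and
`m₀` the standardized mean. -/
noncomputable def fittedKL (n : ℕ) (ld : ℝ) (lam m₀ : Fin d → ℝ)
    (q : EuclideanSpace ℝ (Fin d) × (Fin d → EuclideanSpace ℝ (Fin m))) : ℝ :=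
  (ld + Real.log (gram ℝ q.2).det - d * Real.log n + n * ∑ i, (lam i)⁻¹ * (gram ℝ q.2)⁻¹ i i - d +
    (√(n : ℝ) • m₀ + q.1.ofLp) ⬝ᵥ (gram ℝ q.2)⁻¹.mulVec (√(n : ℝ) • m₀ + q.1.ofLp)) / 2

lemma measurable_fittedKL (ld : ℝ) (lam m₀ : Fin d → ℝ) :
    Measurable (fittedKL (m := m) n ld lam m₀) := by
  have key : ∀ (D : EuclideanSpace ℝ (Fin d) × (Fin d → EuclideanSpace ℝ (Fin m)) → ℝ)
      (G : EuclideanSpace ℝ (Fin d) × (Fin d → EuclideanSpace ℝ (Fin m)) →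
        Matrix (Fin d) (Fin d) ℝ), Measurable D → (∀ i j, Measurable fun q => G q i j) →
      Measurable fun q => (ld + Real.log (D q) - d * Real.log n +
        n * ∑ i, (lam i)⁻¹ * G q i i - d + ∑ i, (√(n : ℝ) * m₀ i + q.1 i) *
          ∑ j, G q i j * (√(n : ℝ) * m₀ j + q.1 j)) / 2 := by
    intro D G hD hG
    fun_prop
  exact key _ _ (measurable_det_gram.comp measurable_snd) fun i j =>
    (measurable_inv_gram i j).comp measurable_snd

/-- The fitted covariance is `B (G/n) Bᵀ`. Its determinant splits, cyclicity turns the trace into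
one against `(BᵀB)⁻¹ = diag(λ⁻¹)`, and `B` cancels in the mean term because the fitted mean lies in
its image. -/
lemma klDiv_gHat_affine {S B : Matrix (Fin d) (Fin d) ℝ} (hS : S.PosDef)
    (hB : B * B.transpose = S) {lam : Fin d → ℝ} (hlam : ∀ i, 0 < lam i)
    (hB' : B.transpose * B = Matrix.diagonal lam) (m₀ : EuclideanSpace ℝ (Fin d))
    {b : OrthonormalBasis (Fin (m + 1)) ℝ (EuclideanSpace ℝ (Fin n))} (hn : n ≠ 0)
    (hb : b 0 = WithLp.toLp 2 fun _ => 1 / √(n : ℝ)) {z : Fin n → EuclideanSpace ℝ (Fin d)}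
    (hz : LinearIndependent ℝ (rotTail b z)) :
    klDiv (f d) (gHat fun k => Matrix.toEuclideanCLM (𝕜 := ℝ) B m₀ +
      Matrix.toEuclideanCLM (𝕜 := ℝ) B (z k)) =
      ENNReal.ofReal (fittedKL n (Real.log S.det) lam m₀.ofLp (rotHead b z, rotTail b z)) ∧
      0 ≤ fittedKL n (Real.log S.det) lam m₀.ofLp (rotHead b z, rotTail b z) := by
  have hn0 : (0 : ℝ) < n := by exact_mod_cast Nat.pos_of_ne_zero hn
  have hBu : IsUnit B.det := by
    refine isUnit_iff_ne_zero.2 fun h => hS.det_pos.ne' ?_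
    rw [← hB, Matrix.det_mul, h, zero_mul]
  set G := gram ℝ (rotTail b z) with hG
  have hGp : G.PosDef := Matrix.posDef_gram_of_linearIndependent hz
  have hcov : sampleCov (fun k => Matrix.toEuclideanCLM (𝕜 := ℝ) B m₀ +
      Matrix.toEuclideanCLM (𝕜 := ℝ) B (z k)) = (1 / (n : ℝ)) • (B * G * B.transpose) := by
    rw [sampleCov_affine hn, sampleCov_eq_gram_rotTail hb, Matrix.mul_smul, Matrix.smul_mul]
  have hP : ((1 / (n : ℝ)) • (B * G * B.transpose)).PosDef := by
    refine Matrix.PosDef.smul ?_ (by positivity)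
    have := hGp.mul_mul_conjTranspose_same (B := B)
      (Matrix.vecMul_injective_iff_isUnit.2 ((Matrix.isUnit_iff_isUnit_det _).2 hBu))
    rwa [Matrix.conjTranspose_eq_transpose_of_trivial] at this
  have hinv : ((1 / (n : ℝ)) • (B * G * B.transpose))⁻¹ =
      (n : ℝ) • ((B⁻¹).transpose * G⁻¹ * B⁻¹) := by
    refine Matrix.inv_eq_left_inv ?_
    rw [Matrix.smul_mul, Matrix.mul_smul, smul_smul, mul_one_div_cancel hn0.ne', one_smul,
      Matrix.mul_assoc _ B⁻¹, ← Matrix.mul_assoc B⁻¹, ← Matrix.mul_assoc B⁻¹,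
      Matrix.nonsing_inv_mul _ hBu, Matrix.one_mul, Matrix.mul_assoc _ G⁻¹,
      ← Matrix.mul_assoc G⁻¹, Matrix.nonsing_inv_mul _ hGp.det_pos.ne'.isUnit, Matrix.one_mul,
      ← Matrix.transpose_mul, Matrix.mul_nonsing_inv _ hBu, Matrix.transpose_one]
  have hdet : Real.log ((1 / (n : ℝ)) • (B * G * B.transpose)).det =
      Real.log S.det + Real.log G.det - d * Real.log n := by
    have hSd : B.det * B.transpose.det = S.det := by rw [← Matrix.det_mul, hB]
    have e : ((1 / (n : ℝ)) • (B * G * B.transpose)).det =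
        (n ^ d : ℝ)⁻¹ * (S.det * G.det) := by
      rw [Matrix.det_smul, Matrix.det_mul, Matrix.det_mul, ← hSd, Fintype.card_fin, one_div,
        inv_pow]
      ring
    rw [e, Real.log_mul (by positivity) (mul_pos hS.det_pos hGp.det_pos).ne', Real.log_inv,
      Real.log_pow, Real.log_mul hS.det_pos.ne' hGp.det_pos.ne']
    ring
  have htr : ((n : ℝ) • ((B⁻¹).transpose * G⁻¹ * B⁻¹)).trace =
      n * ∑ i, (lam i)⁻¹ * G⁻¹ i i := by
    have hd : (Matrix.diagonal lam)⁻¹ = Matrix.diagonal fun i => (lam i)⁻¹ := by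
      refine Matrix.inv_eq_left_inv ?_
      rw [Matrix.diagonal_mul_diagonal, ← Matrix.diagonal_one]
      congr 1 with i
      exact inv_mul_cancel₀ (hlam i).ne'
    rw [Matrix.trace_smul, Matrix.mul_assoc, Matrix.trace_mul_comm, Matrix.mul_assoc,
      Matrix.transpose_nonsing_inv, ← Matrix.mul_inv_rev, hB', hd, smul_eq_mul, Matrix.trace]
    congr 1
    refine Finset.sum_congr rfl fun i _ => ?_
    rw [Matrix.diag_apply, Matrix.mul_diagonal, mul_comm]
  have hmean : sampleMean (fun k => Matrix.toEuclideanCLM (𝕜 := ℝ) B m₀ +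
      Matrix.toEuclideanCLM (𝕜 := ℝ) B (z k)) =
      Matrix.toEuclideanCLM (𝕜 := ℝ) B (m₀ + (1 / √(n : ℝ)) • rotHead b z) := by
    rw [sampleMean_affine hn, sampleMean_eq_rotHead hb, map_add]
  set w := rotHead b z with hw
  have hquad : (B.mulVec (m₀ + (1 / √(n : ℝ)) • w).ofLp) ⬝ᵥ
      ((n : ℝ) • ((B⁻¹).transpose * G⁻¹ * B⁻¹)).mulVec
        (B.mulVec (m₀ + (1 / √(n : ℝ)) • w).ofLp) =
      (√(n : ℝ) • m₀.ofLp + w.ofLp) ⬝ᵥ G⁻¹.mulVec (√(n : ℝ) • m₀.ofLp + w.ofLp) := by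
    have hs : √(n : ℝ) * √(n : ℝ) = n := Real.mul_self_sqrt hn0.le
    have hs0 : √(n : ℝ) ≠ 0 := (Real.sqrt_pos.2 hn0).ne'
    set u := (m₀ + (1 / √(n : ℝ)) • w).ofLp with hu
    have hu' : √(n : ℝ) • m₀.ofLp + w.ofLp = √(n : ℝ) • u := by
      rw [hu, WithLp.ofLp_add, WithLp.ofLp_smul, smul_add, smul_smul, mul_one_div_cancel hs0,
        one_smul]
    rw [hu', Matrix.mulVec_smul, smul_dotProduct, dotProduct_smul, smul_eq_mul, smul_eq_mul,
      ← mul_assoc, hs, Matrix.smul_mulVec, dotProduct_smul, smul_eq_mul, Matrix.mulVec_mulVec,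
      Matrix.mul_assoc, Matrix.nonsing_inv_mul _ hBu, Matrix.mul_one, ← Matrix.mulVec_mulVec,
      Matrix.dotProduct_mulVec, Matrix.vecMul_transpose, Matrix.mulVec_mulVec,
      Matrix.nonsing_inv_mul _ hBu, Matrix.one_mulVec]
  have hnn := gaussianKL_nonneg hP (B.mulVec (m₀ + (1 / √(n : ℝ)) • w).ofLp)
  have hkl := klDiv_multivariateGaussian
    (Matrix.toEuclideanCLM (𝕜 := ℝ) B (m₀ + (1 / √(n : ℝ)) • w)) hP
  rw [hinv, hdet, htr, hquad] at hnn
  rw [hinv, hdet, htr, Matrix.ofLp_toEuclideanCLM, hquad] at hkl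
  rw [gHat, hcov, hmean]
  exact ⟨hkl, hnn⟩

end Divergence

end GaussianIS

namespace GaussianIS

open scoped RealInnerProductSpace MatrixOrder
open Matrix (gram)

/-! ### Expectation of the fitted divergence -/

section Expectation

variable {d m n : ℕ}

/-- The law of the rotated standardized sample. -/
noncomputable abbrev rotatedLaw (d m : ℕ) :
    Measure (EuclideanSpace ℝ (Fin d) × (Fin d → EuclideanSpace ℝ (Fin m))) :=
  (f d).prod (Measure.pi fun _ => stdGaussian (EuclideanSpace ℝ (Fin m)))

lemma ae_rotatedLaw_linearIndependent (hd : d ≤ m) :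
    ∀ᵐ q ∂(rotatedLaw d m), LinearIndependent ℝ q.2 :=
  (Measure.quasiMeasurePreserving_snd (μ := f d)).ae
    (ae_linearIndependent (E := EuclideanSpace ℝ (Fin m)) (d := d) (by simpa using hd))

lemma expectedKL_eq {Ω : Type*} [MeasurableSpace Ω] {P : Measure Ω} [IsProbabilityMeasure P]
    {Y : Fin n → Ω → EuclideanSpace ℝ (Fin d)} {S B : Matrix (Fin d) (Fin d) ℝ} (hS : S.PosDef)
    (hB : B * B.transpose = S) {lam : Fin d → ℝ} (hlam : ∀ i, 0 < lam i)
    (hB' : B.transpose * B = Matrix.diagonal lam) (m₀ : EuclideanSpace ℝ (Fin d))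
    (hlaw : ∀ k, HasLaw (Y k) (multivariateGaussian (Matrix.toEuclideanCLM (𝕜 := ℝ) B m₀) S) P)
    (hindep : iIndepFun Y P) (hn : n = m + 1) (hd : d ≤ m) :
    expectedKL P Y =
      ∫⁻ q, ENNReal.ofReal (fittedKL n (Real.log S.det) lam m₀.ofLp q) ∂(rotatedLaw d m) ∧
    ∀ᵐ q ∂(rotatedLaw d m), 0 ≤ fittedKL n (Real.log S.det) lam m₀.ofLp q := by
  subst hn
  have hBu : IsUnit B.det := by
    refine isUnit_iff_ne_zero.2 fun h => hS.det_pos.ne' ?_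
    rw [← hB, Matrix.det_mul, h, zero_mul]
  obtain ⟨b, hb⟩ := exists_orthonormalBasis_head_const m
  set v := Matrix.toEuclideanCLM (𝕜 := ℝ) B m₀ with hv
  set std : EuclideanSpace ℝ (Fin d) → EuclideanSpace ℝ (Fin d) :=
    fun y => Matrix.toEuclideanCLM (𝕜 := ℝ) B⁻¹ (y - v) with hstd
  have hstdm : Measurable std := by fun_prop
  have hstdlaw : HasLaw std (f d) (multivariateGaussian v S) :=
    ⟨hstdm.aemeasurable, map_standardize_multivariateGaussian hS hB v⟩
  have hZ : ∀ k, HasLaw (fun ω => std (Y k ω)) (f d) P := fun k => hstdlaw.fun_comp (hlaw k)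
  have hZi : iIndepFun (fun k ω => std (Y k ω)) P := hindep.comp (fun _ => std) fun _ => hstdm
  have hZlaw : HasLaw (fun ω k => std (Y k ω)) (Measure.pi fun _ : Fin (m + 1) => f d) P := by
    refine ⟨aemeasurable_pi_lambda _ fun k => (hZ k).aemeasurable, ?_⟩
    rw [(iIndepFun_iff_map_fun_eq_pi_map fun k => (hZ k).aemeasurable).1 hZi]
    congr 1 with k : 1
    exact (hZ k).map_eq
  have hW := (hasLaw_rotation (d := d) b).fun_comp hZlaw
  have hYZ : ∀ k ω, Y k ω = v + Matrix.toEuclideanCLM (𝕜 := ℝ) B (std (Y k ω)) := by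
    intro k ω
    rw [hstd]
    simp only
    rw [← ContinuousLinearMap.comp_apply, ← ContinuousLinearMap.mul_def, ← map_mul,
      Matrix.mul_nonsing_inv _ hBu, map_one, one_apply_eq_self]
    abel
  have hLI : ∀ᵐ ω ∂P, LinearIndependent ℝ (rotTail b fun k => std (Y k ω)) :=
    (hW.ae_iff (p := fun q => LinearIndependent ℝ q.2)
      (measurableSet_setOfPred.1 (measurableSet_linearIndependent.preimage measurable_snd))).2
      (ae_rotatedLaw_linearIndependent hd)
  have hm := measurable_fittedKL (m := m) (n := m + 1) (Real.log S.det) lam m₀.ofLp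
  constructor
  · rw [← hW.lintegral_comp (by fun_prop), expectedKL]
    refine lintegral_congr_ae ?_
    filter_upwards [hLI] with ω hω
    rw [← (klDiv_gHat_affine hS hB hlam hB' m₀ (Nat.succ_ne_zero m) hb hω).1]
    simp_rw [← hv, ← hYZ]
  · refine (hW.ae_iff (measurableSet_setOfPred.1 (measurableSet_le measurable_const hm))).1 ?_
    filter_upwards [hLI] with ω hω
    exact (klDiv_gHat_affine hS hB hlam hB' m₀ (Nat.succ_ne_zero m) hb hω).2

lemma integral_sum_inv_gram (hd : d + 2 ≤ m) (a : Fin d → ℝ) :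
    Integrable (fun q => ∑ i, a i * (gram ℝ q.2)⁻¹ i i) (rotatedLaw d m) ∧
      ∫ q, ∑ i, a i * (gram ℝ q.2)⁻¹ i i ∂(rotatedLaw d m) =
        ∑ i, a i * ∫ x, (gram ℝ x)⁻¹ i i
          ∂(Measure.pi fun _ : Fin d => stdGaussian (EuclideanSpace ℝ (Fin m))) := by
  have hd' : d + 2 ≤ Module.finrank ℝ (EuclideanSpace ℝ (Fin m)) := by simpa using hd
  have h : ∀ i, Integrable (fun q : EuclideanSpace ℝ (Fin d) ×
      (Fin d → EuclideanSpace ℝ (Fin m)) => a i * (gram ℝ q.2)⁻¹ i i) (rotatedLaw d m) := fun i =>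
    ((integral_inv_gram_le hd' i).1.comp_snd (f d)).const_mul (a i)
  refine ⟨integrable_finsetSum _ fun i _ => h i, ?_⟩
  rw [integral_finsetSum _ fun i _ => h i]
  refine Finset.sum_congr rfl fun i _ => ?_
  rw [integral_const_mul, integral_fun_snd (fun x => (gram ℝ x)⁻¹ i i)]
  simp

/-- Head and Gram matrix are independent, so each term factors; the off-diagonal inverse entries
have mean zero. -/
lemma integral_quadratic_inv_gram (hd : d + 2 ≤ m) (u : Fin d → ℝ) :
    Integrable (fun q => (u + q.1.ofLp) ⬝ᵥ (gram ℝ q.2)⁻¹.mulVec (u + q.1.ofLp))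
      (rotatedLaw d m) ∧
      ∫ q, (u + q.1.ofLp) ⬝ᵥ (gram ℝ q.2)⁻¹.mulVec (u + q.1.ofLp) ∂(rotatedLaw d m) =
        ∑ i, (u i ^ 2 + 1) * ∫ x, (gram ℝ x)⁻¹ i i
          ∂(Measure.pi fun _ : Fin d => stdGaussian (EuclideanSpace ℝ (Fin m))) := by
  have hd' : d + 2 ≤ Module.finrank ℝ (EuclideanSpace ℝ (Fin m)) := by simpa using hd
  have hq : ∀ q : EuclideanSpace ℝ (Fin d) × (Fin d → EuclideanSpace ℝ (Fin m)),
      (u + q.1.ofLp) ⬝ᵥ (gram ℝ q.2)⁻¹.mulVec (u + q.1.ofLp) =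
        ∑ i, ∑ j, ((u i + q.1 i) * (u j + q.1 j)) * (gram ℝ q.2)⁻¹ i j := by
    intro q
    simp only [dotProduct, Matrix.mulVec, Finset.mul_sum, Pi.add_apply]
    exact Finset.sum_congr rfl fun i _ => Finset.sum_congr rfl fun j _ => by ring
  have hI : ∀ i j, Integrable (fun q : EuclideanSpace ℝ (Fin d) ×
      (Fin d → EuclideanSpace ℝ (Fin m)) =>
        ((u i + q.1 i) * (u j + q.1 j)) * (gram ℝ q.2)⁻¹ i j) (rotatedLaw d m) := fun i j =>
    (integral_add_coord_mul_add_coord u i j).1.mul_prod (integrable_inv_gram hd' i j)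
  have hE : ∀ i j, ∫ q, ((u i + q.1 i) * (u j + q.1 j)) * (gram ℝ q.2)⁻¹ i j ∂(rotatedLaw d m) =
      if i = j then (u i ^ 2 + 1) * ∫ x, (gram ℝ x)⁻¹ i i
          ∂(Measure.pi fun _ : Fin d => stdGaussian (EuclideanSpace ℝ (Fin m))) else 0 := by
    intro i j
    rw [integral_prod_mul (fun w : EuclideanSpace ℝ (Fin d) => (u i + w i) * (u j + w j))
      (fun x : Fin d → EuclideanSpace ℝ (Fin m) => (gram ℝ x)⁻¹ i j),
      (integral_add_coord_mul_add_coord u i j).2]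
    split_ifs with hij
    · subst hij
      rw [Matrix.one_apply_eq, sq]
    · rw [integral_inv_gram_ne hij, mul_zero]
  simp_rw [hq]
  refine ⟨integrable_finsetSum _ fun i _ => integrable_finsetSum _ fun j _ => hI i j, ?_⟩
  rw [integral_finsetSum _ fun i _ => integrable_finsetSum _ fun j _ => hI i j]
  simp_rw [integral_finsetSum _ fun j _ => hI _ j, hE]
  simp

lemma integral_trace_gram :
    Integrable (fun q => (gram ℝ q.2).trace) (rotatedLaw d m) ∧
      ∫ q, (gram ℝ q.2).trace ∂(rotatedLaw d m) = d * m := by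
  have h : ∀ q : EuclideanSpace ℝ (Fin d) × (Fin d → EuclideanSpace ℝ (Fin m)),
      (gram ℝ q.2).trace = ∑ i, ‖q.2 i‖ ^ 2 := fun q => by
    simp [Matrix.trace, Matrix.gram_apply]
  have hx : ∀ i : Fin d, Integrable (fun x : Fin d → EuclideanSpace ℝ (Fin m) => ‖x i‖ ^ 2)
      (Measure.pi fun _ => stdGaussian (EuclideanSpace ℝ (Fin m))) := fun i =>
    integrable_comp_eval (μ := fun _ : Fin d => stdGaussian (EuclideanSpace ℝ (Fin m))) (i := i)
      (f := fun y : EuclideanSpace ℝ (Fin m) => ‖y‖ ^ 2) integrable_norm_sq_stdGaussian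
  have hI : ∀ i, Integrable (fun q : EuclideanSpace ℝ (Fin d) ×
      (Fin d → EuclideanSpace ℝ (Fin m)) => ‖q.2 i‖ ^ 2) (rotatedLaw d m) := fun i =>
    (hx i).comp_snd (f d)
  simp_rw [h]
  refine ⟨integrable_finsetSum _ fun i _ => hI i, ?_⟩
  rw [integral_finsetSum _ fun i _ => hI i]
  have hE : ∀ i : Fin d, ∫ q, ‖q.2 i‖ ^ 2 ∂(rotatedLaw d m) = m := by
    intro i
    rw [integral_fun_snd (fun x : Fin d → EuclideanSpace ℝ (Fin m) => ‖x i‖ ^ 2),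
      integral_comp_eval (X := fun _ : Fin d => EuclideanSpace ℝ (Fin m))
        (μ := fun _ => stdGaussian (EuclideanSpace ℝ (Fin m)))
        (f := fun y : EuclideanSpace ℝ (Fin m) => ‖y‖ ^ 2) (by fun_prop),
      integral_norm_sq_stdGaussian]
    simp
  simp [hE]

lemma log_det_gram_le {x : Fin d → EuclideanSpace ℝ (Fin m)} (hx : LinearIndependent ℝ x)
    (hn : n ≠ 0) :
    Real.log (gram ℝ x).det ≤ 1 / n * (gram ℝ x).trace + (d * Real.log n - d) := by
  have hn0 : (0 : ℝ) < n := by exact_mod_cast Nat.pos_of_ne_zero hn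
  have hG := Matrix.posDef_gram_of_linearIndependent hx
  have h := log_det_le_trace_sub (hG.smul (by positivity : (0 : ℝ) < 1 / n))
  rw [Matrix.det_smul, Matrix.trace_smul, Real.log_mul (by positivity) hG.det_pos.ne',
    Real.log_pow, one_div, Real.log_inv, Fintype.card_fin, smul_eq_mul] at h
  rw [one_div]
  linarith

/-- Lets a minorant of the divergence take negative values: truncation at zero only helps. -/
lemma ofReal_integral_le_lintegral_ofReal {α : Type*} [MeasurableSpace α] {μ : Measure α}
    {g : α → ℝ} (hg : Integrable g μ) :
    ENNReal.ofReal (∫ x, g x ∂μ) ≤ ∫⁻ x, ENNReal.ofReal (g x) ∂μ := by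
  rw [integral_eq_lintegral_pos_part_sub_lintegral_neg_part hg]
  refine (ENNReal.ofReal_le_ofReal (sub_le_self _ ENNReal.toReal_nonneg)).trans ?_
  exact ENNReal.ofReal_toReal_le

/-- The log-determinant is replaced by the majorant `tr (G/n) - d + d log n`, whose first two terms
have mean `dm/n - d ≤ 0`; each diagonal inverse entry has mean at most `1/(n-d-2)`. -/
lemma lintegral_fittedKL_le (hn : n = m + 1) (hd : d + 3 ≤ n) (ld : ℝ) {lam : Fin d → ℝ}
    (hlam : ∀ i, 0 < lam i) (m₀ : Fin d → ℝ)
    (h0 : ∀ᵐ q ∂(rotatedLaw d m), 0 ≤ fittedKL n ld lam m₀ q) :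
    ∫⁻ q, ENNReal.ofReal (fittedKL n ld lam m₀ q) ∂(rotatedLaw d m) ≤
      ENNReal.ofReal ((ld - d + 1 / (n - d - 2) *
        (n * ∑ i, (lam i)⁻¹ + (n * ∑ i, m₀ i ^ 2 + d))) / 2) := by
  have hn' : (n : ℝ) = m + 1 := by rw [hn]; push_cast; rfl
  have hdn : (d + 3 : ℝ) ≤ n := by exact_mod_cast hd
  have hd2 : d + 2 ≤ m := by omega
  have hn0 : (0 : ℝ) < n := by linarith
  obtain ⟨t1, t2⟩ := integral_trace_gram (d := d) (m := m)
  obtain ⟨s1, s2⟩ := integral_sum_inv_gram hd2 fun i => (lam i)⁻¹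
  obtain ⟨q1, q2⟩ := integral_quadratic_inv_gram hd2 (√(n : ℝ) • m₀)
  have hIle : ∀ i : Fin d, ∫ x, (gram ℝ x)⁻¹ i i
      ∂(Measure.pi fun _ : Fin d => stdGaussian (EuclideanSpace ℝ (Fin m))) ≤
      1 / (n - d - 2) := by
    intro i
    have := (integral_inv_gram_le (E := EuclideanSpace ℝ (Fin m)) (d := d) (by simpa using hd2) i).2
    rw [finrank_euclideanSpace_fin] at this
    rwa [show (n - d - 2 : ℝ) = m - d - 1 by rw [hn']; ring]
  set U : EuclideanSpace ℝ (Fin d) × (Fin d → EuclideanSpace ℝ (Fin m)) → ℝ := fun q =>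
    (ld - d - d) + (1 / n * (gram ℝ q.2).trace + (n * ∑ i, (lam i)⁻¹ * (gram ℝ q.2)⁻¹ i i +
      (√(n : ℝ) • m₀ + q.1.ofLp) ⬝ᵥ (gram ℝ q.2)⁻¹.mulVec (√(n : ℝ) • m₀ + q.1.ofLp))) with hU
  have hsq : Integrable (fun q : EuclideanSpace ℝ (Fin d) × (Fin d → EuclideanSpace ℝ (Fin m)) =>
      n * ∑ i, (lam i)⁻¹ * (gram ℝ q.2)⁻¹ i i +
      (√(n : ℝ) • m₀ + q.1.ofLp) ⬝ᵥ (gram ℝ q.2)⁻¹.mulVec (√(n : ℝ) • m₀ + q.1.ofLp))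
      (rotatedLaw d m) := (s1.const_mul _).add q1
  have htsq : Integrable (fun q : EuclideanSpace ℝ (Fin d) × (Fin d → EuclideanSpace ℝ (Fin m)) =>
      1 / n * (gram ℝ q.2).trace + (n * ∑ i, (lam i)⁻¹ * (gram ℝ q.2)⁻¹ i i +
      (√(n : ℝ) • m₀ + q.1.ofLp) ⬝ᵥ (gram ℝ q.2)⁻¹.mulVec (√(n : ℝ) • m₀ + q.1.ofLp)))
      (rotatedLaw d m) := (t1.const_mul _).add hsq
  have hUi : Integrable U (rotatedLaw d m) := (integrable_const _).add htsq
  have hUe : ∫ q, U q ∂(rotatedLaw d m) ≤ ld - d + 1 / (n - d - 2) *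
        (n * ∑ i, (lam i)⁻¹ + (n * ∑ i, m₀ i ^ 2 + d)) := by
    rw [hU, integral_add (integrable_const _) htsq, integral_add (t1.const_mul _) hsq,
      integral_add (s1.const_mul _) q1, integral_const_mul, integral_const_mul, t2, s2, q2]
    have e1 : 1 / n * (d * m : ℝ) ≤ d := by
      rw [one_div, inv_mul_le_iff₀ hn0, hn']
      nlinarith [(Nat.cast_nonneg d : (0 : ℝ) ≤ d)]
    have e2 : ∑ i, (lam i)⁻¹ * ∫ x, (gram ℝ x)⁻¹ i i
        ∂(Measure.pi fun _ : Fin d => stdGaussian (EuclideanSpace ℝ (Fin m))) ≤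
        1 / (n - d - 2) * ∑ i, (lam i)⁻¹ := by
      rw [Finset.mul_sum]
      refine Finset.sum_le_sum fun i _ => ?_
      rw [mul_comm (1 / (n - d - 2 : ℝ))]
      exact mul_le_mul_of_nonneg_left (hIle i) (inv_pos.2 (hlam i)).le
    have e3 : ∑ i, ((√(n : ℝ) • m₀) i ^ 2 + 1) * ∫ x, (gram ℝ x)⁻¹ i i
        ∂(Measure.pi fun _ : Fin d => stdGaussian (EuclideanSpace ℝ (Fin m))) ≤
        1 / (n - d - 2) * (n * ∑ i, m₀ i ^ 2 + d) := by
      have : (n * ∑ i, m₀ i ^ 2 + d : ℝ) = ∑ i : Fin d, ((√(n : ℝ) • m₀) i ^ 2 + 1) := by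
        simp [mul_pow, Finset.sum_add_distrib, ← Finset.mul_sum, Real.sq_sqrt hn0.le]
      rw [this, Finset.mul_sum]
      refine Finset.sum_le_sum fun i _ => ?_
      rw [mul_comm (1 / (n - d - 2 : ℝ))]
      exact mul_le_mul_of_nonneg_left (hIle i) (by positivity)
    have e2' := mul_le_mul_of_nonneg_left e2 hn0.le
    simp only [integral_const, probReal_univ, one_smul]
    linarith
  have hle : ∀ᵐ q ∂(rotatedLaw d m), fittedKL n ld lam m₀ q ≤ U q / 2 := by
    filter_upwards [ae_rotatedLaw_linearIndependent (d := d) (m := m) (by omega)] with q hq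
    have := log_det_gram_le (n := n) hq (by omega)
    rw [fittedKL, hU]
    linarith
  calc ∫⁻ q, ENNReal.ofReal (fittedKL n ld lam m₀ q) ∂(rotatedLaw d m)
      ≤ ∫⁻ q, ENNReal.ofReal (U q / 2) ∂(rotatedLaw d m) :=
        lintegral_mono_ae (hle.mono fun q hq => ENNReal.ofReal_le_ofReal hq)
    _ = ENNReal.ofReal (∫ q, U q / 2 ∂(rotatedLaw d m)) := by
        rw [ofReal_integral_eq_lintegral_ofReal (hUi.div_const 2)]
        filter_upwards [h0, hle] with q hq hq'
        exact hq.trans hq'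
    _ ≤ _ := by
        refine ENNReal.ofReal_le_ofReal ?_
        rw [integral_div]
        linarith

/-- The nonnegative mean term is discarded, the log-determinant is replaced by its integrable
minorant, and each diagonal inverse entry has mean at least `1/(n-d)`. -/
lemma le_lintegral_fittedKL (hn : n = m + 1) (hd : d + 3 ≤ n) (ld : ℝ) {lam : Fin d → ℝ}
    (hlam : ∀ i, 0 < lam i) (m₀ : Fin d → ℝ) :
    ENNReal.ofReal ((ld - d + ∑ i ∈ Finset.range d, Real.log (n - i - 3 : ℝ) - d * Real.log n +
      n / (n - d) * ∑ i, (lam i)⁻¹) / 2) ≤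
      ∫⁻ q, ENNReal.ofReal (fittedKL n ld lam m₀ q) ∂(rotatedLaw d m) := by
  have hn' : (n : ℝ) = m + 1 := by rw [hn]; push_cast; rfl
  have hdn : (d + 3 : ℝ) ≤ n := by exact_mod_cast hd
  have hd2 : d + 2 ≤ m := by omega
  have hn0 : (0 : ℝ) < n := by linarith
  obtain ⟨s1, s2⟩ := integral_sum_inv_gram hd2 fun i => (lam i)⁻¹
  obtain ⟨L, L1, L2, L3⟩ := exists_le_log_det_gram (E := EuclideanSpace ℝ (Fin m)) (d := d)
    (by simpa using hd2)
  rw [finrank_euclideanSpace_fin] at L3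
  have hL1 : Integrable (fun q => L q.2) (rotatedLaw d m) := L1.comp_snd (f d)
  set V : EuclideanSpace ℝ (Fin d) × (Fin d → EuclideanSpace ℝ (Fin m)) → ℝ := fun q =>
    (ld - d * Real.log n - d) + (L q.2 + n * ∑ i, (lam i)⁻¹ * (gram ℝ q.2)⁻¹ i i) with hV
  have hLs : Integrable (fun q : EuclideanSpace ℝ (Fin d) × (Fin d → EuclideanSpace ℝ (Fin m)) =>
      L q.2 + n * ∑ i, (lam i)⁻¹ * (gram ℝ q.2)⁻¹ i i) (rotatedLaw d m) :=
    hL1.add (s1.const_mul _)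
  have hVi : Integrable V (rotatedLaw d m) := (integrable_const _).add hLs
  have hVe : ld - d + ∑ i ∈ Finset.range d, Real.log (n - i - 3 : ℝ) - d * Real.log n +
      n / (n - d) * ∑ i, (lam i)⁻¹ ≤ ∫ q, V q ∂(rotatedLaw d m) := by
    rw [hV, integral_add (integrable_const _) hLs, integral_add hL1 (s1.const_mul _),
      integral_const_mul, s2, integral_fun_snd L]
    have e1 : ∑ i ∈ Finset.range d, Real.log (n - i - 3 : ℝ) =
        ∑ i ∈ Finset.range d, Real.log (m - i - 2 : ℝ) :=
      Finset.sum_congr rfl fun i _ => by rw [hn']; congr 1; ring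
    have e2 : 1 / (n - d : ℝ) * ∑ i, (lam i)⁻¹ ≤ ∑ i, (lam i)⁻¹ * ∫ x, (gram ℝ x)⁻¹ i i
        ∂(Measure.pi fun _ : Fin d => stdGaussian (EuclideanSpace ℝ (Fin m))) := by
      rw [Finset.mul_sum]
      refine Finset.sum_le_sum fun i _ => ?_
      rw [mul_comm]
      refine mul_le_mul_of_nonneg_left ?_ (inv_pos.2 (hlam i)).le
      have := le_integral_inv_gram (E := EuclideanSpace ℝ (Fin m)) (d := d) (by simpa using hd2) i
      rw [finrank_euclideanSpace_fin] at this
      rwa [show (n - d : ℝ) = m - d + 1 by rw [hn']; ring]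
    have e2' := mul_le_mul_of_nonneg_left e2 hn0.le
    have e3 : (n / (n - d) : ℝ) * ∑ i, (lam i)⁻¹ = n * (1 / (n - d : ℝ) * ∑ i, (lam i)⁻¹) := by
      ring
    simp only [integral_const, probReal_univ, one_smul]
    rw [e1, e3]
    linarith
  have hle : ∀ᵐ q ∂(rotatedLaw d m), V q / 2 ≤ fittedKL n ld lam m₀ q := by
    filter_upwards [(Measure.quasiMeasurePreserving_snd (μ := f d)).ae L2] with q hq
    have hG := (Matrix.posSemidef_gram (𝕜 := ℝ) q.2).inv
    have := hG.dotProduct_mulVec_nonneg (√(n : ℝ) • m₀ + q.1.ofLp)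
    rw [star_trivial] at this
    rw [fittedKL, hV]
    linarith
  calc _ ≤ ENNReal.ofReal (∫ q, V q / 2 ∂(rotatedLaw d m)) := by
        refine ENNReal.ofReal_le_ofReal ?_
        rw [integral_div]
        linarith
    _ ≤ ∫⁻ q, ENNReal.ofReal (V q / 2) ∂(rotatedLaw d m) :=
        ofReal_integral_le_lintegral_ofReal (hVi.div_const 2)
    _ ≤ _ := lintegral_mono_ae (hle.mono fun q hq => ENNReal.ofReal_le_ofReal hq)

end Expectation

end GaussianIS

namespace GaussianIS

open scoped RealInnerProductSpace MatrixOrder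

/-! ### Explicit two-sided bounds of order `d²/n` -/

section Bounds

variable {d n : ℕ}

/-- A dimension-free bound for the squared Frobenius distance between the identity and the
covariance of a conditioned standard Gaussian, in terms of the probability `p` of the
conditioning. -/
noncomputable def frobeniusBound (p : ℝ) : ℝ :=
  2 * (p⁻¹ * Var[fun x => x ^ 2 - 1; gaussianReal 0 1]) + 2 * (p⁻¹) ^ 2

lemma exists_standardized_mean {S B : Matrix (Fin d) (Fin d) ℝ} (hS : S.PosDef)
    (hB : B * B.transpose = S) {lam : Fin d → ℝ} {c : ℝ} (hc : 0 < c) (hlam : ∀ i, c ≤ lam i)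
    (hB' : B.transpose * B = Matrix.diagonal lam) (v : EuclideanSpace ℝ (Fin d)) :
    ∃ m₀ : EuclideanSpace ℝ (Fin d), Matrix.toEuclideanCLM (𝕜 := ℝ) B m₀ = v ∧
      ∑ i, m₀ i ^ 2 ≤ ‖v‖ ^ 2 / c := by
  have hBu : IsUnit B.det := by
    refine isUnit_iff_ne_zero.2 fun h => hS.det_pos.ne' ?_
    rw [← hB, Matrix.det_mul, h, zero_mul]
  set m₀ := Matrix.toEuclideanCLM (𝕜 := ℝ) B⁻¹ v with hm₀
  have h1 : Matrix.toEuclideanCLM (𝕜 := ℝ) B m₀ = v := by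
    rw [hm₀, ← ContinuousLinearMap.comp_apply, ← ContinuousLinearMap.mul_def, ← map_mul,
      Matrix.mul_nonsing_inv _ hBu, map_one, one_apply_eq_self]
  have h2 : ‖v‖ ^ 2 = ∑ i, lam i * m₀ i ^ 2 := by
    have e : ‖v‖ ^ 2 = (B.mulVec m₀.ofLp) ⬝ᵥ (B.mulVec m₀.ofLp) := by
      rw [← Matrix.ofLp_toEuclideanCLM, h1, EuclideanSpace.real_norm_sq_eq]
      simp [dotProduct, sq]
    rw [e, Matrix.dotProduct_mulVec, ← Matrix.mulVec_transpose, Matrix.mulVec_mulVec, hB',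
      dotProduct]
    refine Finset.sum_congr rfl fun i _ => ?_
    rw [Matrix.mulVec_diagonal]
    ring
  refine ⟨m₀, h1, ?_⟩
  rw [le_div_iff₀ hc, h2, Finset.sum_mul]
  refine Finset.sum_le_sum fun i _ => ?_
  rw [mul_comm]
  exact mul_le_mul_of_nonneg_right (hlam i) (sq_nonneg _)

lemma sum_log_add_inv_sub_one_nonneg {lam : Fin d → ℝ} (hlam : ∀ i, 0 < lam i) :
    0 ≤ ∑ i, Real.log (lam i) + ∑ i, (lam i)⁻¹ - d := by
  have h : ∀ i, 0 ≤ Real.log (lam i) + (lam i)⁻¹ - 1 := fun i => by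
    have := Real.one_sub_inv_le_log_of_pos (hlam i)
    linarith
  have := Finset.sum_nonneg fun i (_ : i ∈ Finset.univ) => h i
  simpa [Finset.sum_add_distrib, Finset.sum_sub_distrib] using this

/-- Termwise, `log t + 1/t - 1 ≤ t - 2 + 1/t = (t-1)²/t`. -/
lemma sum_log_add_inv_sub_one_le {lam : Fin d → ℝ} {c K : ℝ} (hc : 0 < c)
    (hlam : ∀ i, c ≤ lam i) (hK : ∑ i, (lam i - 1) ^ 2 ≤ K) :
    ∑ i, Real.log (lam i) + ∑ i, (lam i)⁻¹ - d ≤ K / c := by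
  have h : ∀ i, Real.log (lam i) + (lam i)⁻¹ - 1 ≤ (lam i - 1) ^ 2 / c := fun i => by
    have hl : 0 < lam i := hc.trans_le (hlam i)
    have h1 := Real.log_le_sub_one_of_pos hl
    have h2 : (lam i - 1) ^ 2 / lam i = lam i - 2 + (lam i)⁻¹ := by
      field_simp
      ring
    have h3 : (lam i - 1) ^ 2 / lam i ≤ (lam i - 1) ^ 2 / c :=
      div_le_div_of_nonneg_left (sq_nonneg _) hc (hlam i)
    linarith
  have h' := Finset.sum_le_sum fun i (_ : i ∈ Finset.univ) => h i
  rw [← Finset.sum_div] at h'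
  have h2 := h'.trans (div_le_div_of_nonneg_right hK hc.le)
  simpa [Finset.sum_add_distrib, Finset.sum_sub_distrib] using h2

/-- With `s = t - 1`: `1/t ≥ 1 - s ≥ 7/8 - 2s²`, the second step being `2(s - 1/4)² ≥ 0`. Any
constant above `1/2` in place of `7/8` would still beat the loss from the log-determinant. -/
lemma le_sum_inv {lam : Fin d → ℝ} {K : ℝ} (hlam : ∀ i, 0 < lam i)
    (hK : ∑ i, (lam i - 1) ^ 2 ≤ K) : 7 / 8 * d - 2 * K ≤ ∑ i, (lam i)⁻¹ := by
  have h : ∀ i, 7 / 8 - 2 * (lam i - 1) ^ 2 ≤ (lam i)⁻¹ := fun i => by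
    have h1 : 2 - lam i ≤ (lam i)⁻¹ := by
      have h2 : (lam i - 1) ^ 2 / lam i = lam i - 2 + (lam i)⁻¹ := by
        have := (hlam i).ne'
        field_simp
        ring
      have h3 : 0 ≤ (lam i - 1) ^ 2 / lam i := div_nonneg (sq_nonneg _) (hlam i).le
      linarith
    nlinarith [sq_nonneg (lam i - 1 - 1 / 4)]
  have h' := Finset.sum_le_sum fun i (_ : i ∈ Finset.univ) => h i
  rw [Finset.sum_sub_distrib, ← Finset.mul_sum] at h'
  simp only [Finset.sum_const, Finset.card_univ, Fintype.card_fin, nsmul_eq_mul] at h'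
  linarith

lemma sum_range_log_sub_ge (hd : d + 3 ≤ n) :
    -((d ^ 2 + 5 * d) / (2 * (n - d - 2)) : ℝ) ≤
      ∑ i ∈ Finset.range d, Real.log (n - i - 3 : ℝ) - d * Real.log n := by
  have hdn : (d + 3 : ℝ) ≤ n := by exact_mod_cast hd
  have hg : (0 : ℝ) < n - d - 2 := by linarith
  have hn0 : (0 : ℝ) < n := by linarith [(Nat.cast_nonneg d : (0 : ℝ) ≤ d)]
  have h : ∀ i ∈ Finset.range d, -((i + 3 : ℝ) / (n - d - 2)) ≤
      Real.log (n - i - 3 : ℝ) - Real.log n := by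
    intro i hi
    have hi' : (i + 1 : ℝ) ≤ d := by exact_mod_cast Finset.mem_range.1 hi
    have hpos : (0 : ℝ) < n - i - 3 := by linarith
    have h1 := Real.one_sub_inv_le_log_of_pos (div_pos hpos hn0)
    rw [Real.log_div hpos.ne' hn0.ne', inv_div] at h1
    have h2 : 1 - n / (n - i - 3 : ℝ) = -((i + 3 : ℝ) / (n - i - 3)) := by
      field_simp
      ring
    have h3 : (i + 3 : ℝ) / (n - i - 3) ≤ (i + 3 : ℝ) / (n - d - 2) :=
      div_le_div_of_nonneg_left (by positivity) hg (by linarith)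
    linarith
  have h' := Finset.sum_le_sum h
  rw [Finset.sum_neg_distrib, ← Finset.sum_div, Finset.sum_sub_distrib, Finset.sum_const,
    Finset.card_range, nsmul_eq_mul] at h'
  have hs : ∀ e : ℕ, ∑ i ∈ Finset.range e, (i + 3 : ℝ) = (e ^ 2 + 5 * e) / 2 := by
    intro e
    induction e with
    | zero => simp
    | succ e ih =>
      rw [Finset.sum_range_succ, ih]
      push_cast
      ring
  rw [hs, div_div] at h'
  exact h'

lemma expectedKL_bounds {A : Set (EuclideanSpace ℝ (Fin d))} {p : ℝ} (hp : 0 < p)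
    (hpA : ENNReal.ofReal p ≤ f d A) {Ω : Type*} [MeasurableSpace Ω] {P : Measure Ω}
    [IsProbabilityMeasure P] {Y : Fin n → Ω → EuclideanSpace ℝ (Fin d)}
    (hlaw : ∀ k, HasLaw (Y k) (multivariateGaussian (meanA A) (covA A)) P)
    (hindep : iIndepFun Y P) (hd : d + 3 ≤ n) :
    expectedKL P Y ≤ ENNReal.ofReal ((frobeniusBound p / (p ^ 2 / 8) + 1 / (n - d - 2) *
      ((d + 2) * (d / (p ^ 2 / 8)) + n * (p⁻¹ / (p ^ 2 / 8)) + d)) / 2) ∧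
    ENNReal.ofReal (((7 / 8 * d - 2 * frobeniusBound p) * (d / (n - d)) -
      (d ^ 2 + 5 * d) / (2 * (n - d - 2))) / 2) ≤ expectedKL P Y := by
  have hc : 0 < p ^ 2 / 8 := by positivity
  have hS := posDef_covA hp hpA
  obtain ⟨B, hB, hB'⟩ := exists_factorization hS
  set lam := hS.1.eigenvalues with hlamdef
  have hlam : ∀ i, p ^ 2 / 8 ≤ lam i := le_eigenvalues_covA hp hpA
  have hlam0 : ∀ i, 0 < lam i := fun i => hc.trans_le (hlam i)
  have hK : ∑ i, (lam i - 1) ^ 2 ≤ frobeniusBound p := sum_sq_eigenvalues_covA_sub_one_le hp hpA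
  have hld : Real.log (covA A).det = ∑ i, Real.log (lam i) := by
    rw [hS.1.det_eq_prod_eigenvalues]
    simp only [RCLike.ofReal_real_eq_id, id]
    exact Real.log_prod fun i _ => (hlam0 i).ne'
  obtain ⟨m₀, hm₀, hm₀'⟩ := exists_standardized_mean hS hB hc hlam hB' (meanA A)
  obtain ⟨m, rfl⟩ : ∃ m, n = m + 1 := ⟨n - 1, by omega⟩
  obtain ⟨hE, h0⟩ := expectedKL_eq (m := m) hS hB hlam0 hB' m₀ (by rwa [hm₀]) hindep rfl (by omega)
  rw [hE]
  have hup := lintegral_fittedKL_le rfl hd _ hlam0 m₀.ofLp h0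
  have hlow := le_lintegral_fittedKL (m := m) rfl hd (Real.log (covA A).det) hlam0 m₀.ofLp
  set n := m + 1 with hn
  have hdn : (d + 3 : ℝ) ≤ n := by exact_mod_cast hd
  have hd0 : (0 : ℝ) ≤ d := Nat.cast_nonneg d
  have hg : (0 : ℝ) < n - d - 2 := by linarith
  have hn0 : (0 : ℝ) < n := by linarith
  set T := ∑ i, (lam i)⁻¹ with hT
  constructor
  · refine hup.trans (ENNReal.ofReal_le_ofReal ?_)
    have h1 := sum_log_add_inv_sub_one_le hc hlam hK
    rw [← hld] at h1
    have h2 : T ≤ d / (p ^ 2 / 8) := by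
      calc T ≤ ∑ _i : Fin d, (p ^ 2 / 8)⁻¹ :=
            Finset.sum_le_sum fun i _ => inv_anti₀ hc (hlam i)
        _ = d / (p ^ 2 / 8) := by simp [div_eq_mul_inv]
    have h3 : ∑ i, m₀ i ^ 2 ≤ p⁻¹ / (p ^ 2 / 8) :=
      hm₀'.trans (div_le_div_of_nonneg_right (norm_meanA_sq_le hp hpA) hc.le)
    -- Since `n/(n-d-2) = 1 + (d+2)/(n-d-2)`, one copy of `T` splits off and joins `log det Σ_A - d`
    -- in a dimension-free quantity.
    have h4 : 1 / (n - d - 2 : ℝ) * (n * T + (n * ∑ i, m₀ i ^ 2 + d)) =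
        T + 1 / (n - d - 2 : ℝ) * ((d + 2) * T + n * ∑ i, m₀ i ^ 2 + d) := by
      field_simp
      ring
    have h5 : 1 / (n - d - 2 : ℝ) * ((d + 2) * T + n * ∑ i, m₀ i ^ 2 + d) ≤
        1 / (n - d - 2 : ℝ) *
          ((d + 2) * (d / (p ^ 2 / 8)) + n * (p⁻¹ / (p ^ 2 / 8)) + d) := by
      gcongr
    rw [h4]
    linarith
  · refine le_trans (ENNReal.ofReal_le_ofReal ?_) hlow
    have h1 := sum_log_add_inv_sub_one_nonneg hlam0
    rw [← hld] at h1
    have h2 := sum_range_log_sub_ge hd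
    have h3 := le_sum_inv hlam0 hK
    have hnd : (0 : ℝ) < n - d := by linarith
    have h4 : (n / (n - d) : ℝ) * T = T + T * (d / (n - d)) := by
      field_simp
      ring
    have h5 := mul_le_mul_of_nonneg_right h3 (div_nonneg hd0 hnd.le)
    rw [h4]
    linarith

/-- The upper bound is dimension-free as soon as the sample size is at least `6 d²`. -/
lemma upper_bound_le_of_six_mul_sq_le {a b : ℝ} (ha : 0 ≤ a) (hb : 0 ≤ b) (hd : 1 ≤ d)
    (hn : (6 * d ^ 2 : ℝ) ≤ n) :
    1 / (n - d - 2 : ℝ) * ((d + 2) * (d * a) + n * b + d) ≤ a + 2 * b + 1 := by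
  have hd1 : (1 : ℝ) ≤ d := by exact_mod_cast hd
  have hg : (0 : ℝ) < n - d - 2 := by nlinarith
  rw [one_div, inv_mul_le_iff₀ hg]
  have h1 : ((d + 2) * d : ℝ) ≤ n - d - 2 := by nlinarith
  have h2 : (n : ℝ) ≤ (n - d - 2) * 2 := by nlinarith
  have h3 : (d : ℝ) ≤ n - d - 2 := by nlinarith
  have h1' := mul_le_mul_of_nonneg_right h1 ha
  have h2' := mul_le_mul_of_nonneg_right h2 hb
  linarith

/-- A crude bound for the finitely many dimensions where `n` may be below `6 d²`: as `n - d - 2 ≥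
1`, one has `n/(n-d-2) ≤ d + 3`. -/
lemma upper_bound_le_of_le {a b : ℝ} {D : ℕ} (ha : 0 ≤ a) (hb : 0 ≤ b) (hD : d ≤ D)
    (hn : d + 3 ≤ n) :
    1 / (n - d - 2 : ℝ) * ((d + 2) * (d * a) + n * b + d) ≤
      (D + 2) * (D * a) + (D + 3) * b + D := by
  have hdn : (d + 3 : ℝ) ≤ n := by exact_mod_cast hn
  have hdD : (d : ℝ) ≤ D := by exact_mod_cast hD
  have hd0 : (0 : ℝ) ≤ d := Nat.cast_nonneg d
  have hg : (1 : ℝ) ≤ n - d - 2 := by linarith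
  have h1 : 1 / (n - d - 2 : ℝ) * ((d + 2) * (d * a) + n * b + d) ≤
      (d + 2) * (d * a) + (d + 3) * b + d := by
    rw [one_div, inv_mul_le_iff₀ (by linarith)]
    have h2 : 0 ≤ (n - d - 3) * ((d + 2) * (d * a) + (d + 2) * b + d) :=
      mul_nonneg (by linarith) (by positivity)
    linarith
  refine h1.trans ?_
  gcongr

/-- In units of `d²/n`: `2K ≤ d/56` leaves a gain of `7/8 - 1/56 = 6/7`; `5d ≤ d²/8` and `d + 2 ≤
n/8` bound the loss by `9/14`. The difference is `3/14`. -/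
lemma lower_bound_ge {K : ℝ} (hd : 40 ≤ d) (hdK : 112 * K ≤ d)
    (hn : (16 * d : ℝ) ≤ n) :
    3 / 14 * ((d : ℝ) ^ 2 / n) ≤ (7 / 8 * d - 2 * K) * (d / (n - d)) -
      (d ^ 2 + 5 * d) / (2 * (n - d - 2)) := by
  have hd1 : (40 : ℝ) ≤ d := by exact_mod_cast hd
  have hn0 : (0 : ℝ) < n := by linarith
  have h1 : (d / n : ℝ) ≤ d / (n - d) :=
    div_le_div_of_nonneg_left (by linarith) (by linarith) (by linarith)
  have h2 : (7 / 8 - 1 / 56) * d * (d / n : ℝ) ≤ (7 / 8 * d - 2 * K) * (d / (n - d)) := by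
    refine mul_le_mul (by linarith) h1 (by positivity) (by linarith)
  have h3 : ((d ^ 2 + 5 * d) / (2 * (n - d - 2)) : ℝ) ≤ (9 / 8 * d ^ 2) / (2 * (7 / 8 * n)) := by
    apply div_le_div₀
    · positivity
    · nlinarith
    · positivity
    · linarith
  have h4 : ((9 / 8 * d ^ 2) / (2 * (7 / 8 * n)) : ℝ) = 9 / 14 * (d ^ 2 / n) := by
    field_simp
    norm_num
  have h5 : ((7 / 8 - 1 / 56) * d * (d / n) : ℝ) = 6 / 7 * (d ^ 2 / n) := by
    field_simp
    norm_num
  linarith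

end Bounds

end GaussianIS

/-! ### The two regimes -/

theorem proposition1
    (A : ∀ d : ℕ, Set (EuclideanSpace ℝ (Fin d)))
    (hA : ∀ d, 1 ≤ d → MeasurableSet (A d))
    (hpos : 0 < ⨅ (d : ℕ) (_ : 1 ≤ d), GaussianIS.f d (A d))
    (n : ℕ → ℕ)
    {Ω : ℕ → Type*} [∀ d, MeasurableSpace (Ω d)]
    (P : ∀ d, Measure (Ω d)) [∀ d, IsProbabilityMeasure (P d)]
    (Y : ∀ d, Fin (n d) → Ω d → EuclideanSpace ℝ (Fin d))
    (hlaw : ∀ d, 1 ≤ d → ∀ k, HasLaw (Y d k)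
      (multivariateGaussian (GaussianIS.meanA (A d)) (GaussianIS.covA (A d))) (P d))
    (hindep : ∀ d, 1 ≤ d → iIndepFun (Y d) (P d))
    (hn : GaussianIS.MuchLarger (fun d => (n d : ℝ)) (fun d => (d : ℝ))) :
    (GaussianIS.MuchLarger (fun d => (n d : ℝ)) (fun d => (d : ℝ) ^ 2) →
      (⨆ (d : ℕ) (_ : 1 ≤ d) (_ : d + 3 ≤ n d), GaussianIS.expectedKL (P d) (Y d)) < ∞) ∧
    (GaussianIS.MuchLarger (fun d => (d : ℝ) ^ 2) (fun d => (n d : ℝ)) →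
      Tendsto (fun d => GaussianIS.expectedKL (P d) (Y d)) atTop (𝓝 ∞)) := by
  obtain ⟨r, hr0, hr⟩ := ENNReal.lt_iff_exists_nnreal_btwn.1 hpos
  set p : ℝ := (r : ℝ) with hpdef
  have hp : 0 < p := by exact_mod_cast hr0
  have hpA : ∀ d, 1 ≤ d → ENNReal.ofReal p ≤ GaussianIS.f d (A d) := fun d hd => by
    rw [hpdef, ENNReal.ofReal_coe_nnreal]
    exact hr.le.trans (iInf₂_le d hd)
  have hbounds := fun d (hd : 1 ≤ d) (hdn : d + 3 ≤ n d) =>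
    GaussianIS.expectedKL_bounds hp (hpA d hd) (hlaw d hd) (hindep d hd) hdn
  set K := GaussianIS.frobeniusBound p
  constructor
  · intro hn2
    obtain ⟨D, hD⟩ := eventually_atTop.1 (tendsto_atTop.1 hn2 6)
    set a : ℝ := (p ^ 2 / 8)⁻¹ with ha
    set b : ℝ := p⁻¹ / (p ^ 2 / 8) with hb
    have ha0 : 0 ≤ a := by positivity
    have hb0 : 0 ≤ b := by positivity
    -- The sum of the bounds for `d ≥ D` and `d ≤ D`, both nonnegative, replaces their maximum.
    refine lt_of_le_of_lt (b := ENNReal.ofReal ((K / (p ^ 2 / 8) +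
      ((a + 2 * b + 1) + ((D + 2) * (D * a) + (D + 3) * b + D))) / 2)) ?_ ENNReal.ofReal_lt_top
    refine iSup_le fun d => iSup_le fun hd => iSup_le fun hdn => ?_
    refine (hbounds d hd hdn).1.trans (ENNReal.ofReal_le_ofReal ?_)
    rw [div_eq_mul_inv (d : ℝ)]
    rcases le_total D d with h | h
    · have hd0 : (0 : ℝ) < d := by exact_mod_cast hd
      have h6 : (6 * d ^ 2 : ℝ) ≤ n d := (le_div_iff₀ (by positivity)).1 (hD d h)
      have h1 := GaussianIS.upper_bound_le_of_six_mul_sq_le ha0 hb0 hd h6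
      have h2 : 0 ≤ (D + 2) * (D * a) + (D + 3) * b + D := by positivity
      linarith
    · have h1 := GaussianIS.upper_bound_le_of_le ha0 hb0 h hdn
      have h2 : 0 ≤ a + 2 * b + 1 := by positivity
      linarith
  · intro hn2
    have hlim : Tendsto (fun d : ℕ => ENNReal.ofReal (3 / 14 * ((d : ℝ) ^ 2 / n d) / 2)) atTop
        (𝓝 ∞) :=
      ENNReal.tendsto_ofReal_nhds_top.2
        ((hn2.const_mul_atTop (by norm_num : (0 : ℝ) < 3 / 14)).atTop_div_const two_pos)
    refine tendsto_nhds_top_mono hlim ?_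
    filter_upwards [tendsto_atTop.1 hn 16, eventually_ge_atTop 40,
      eventually_ge_atTop ⌈112 * K⌉₊] with d h16 h40 hdK
    have hd0 : (0 : ℝ) < d := by exact_mod_cast (by omega : 0 < d)
    have h16' : (16 * d : ℝ) ≤ n d := (le_div_iff₀ hd0).1 h16
    have hnat : 16 * d ≤ n d := by exact_mod_cast h16'
    refine le_trans (ENNReal.ofReal_le_ofReal ?_) (hbounds d (by omega) (by omega)).2
    have := GaussianIS.lower_bound_ge h40 (Nat.ceil_le.1 hdK) h16'
    linarith
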